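/- Let $g:[0,\infty)\to[0,1]$ be non-increasing with $g(x)=o\!\left(\frac{1}{x^{2}\log^{2}x}\right)$ as $x\to\infty$, and suppose that $C:=\int_{\mathbb{R}^2} g(\|\boldsymbol{x}\|)\,d\boldsymbol{x}>0$, where $\|\cdot\|$ is the Euclidean norm (the decay of $g$ makes $C$ finite). Let $b$ be a real constant; the case $b=+\infty$ is also allowed, in the sense that $b=b(\rho)$ is a real function of $\rho$ with $b(\rho)\to+\infty$ as $\rho\to\infty$. For all sufficiently large $\rho$ put $$r_\rho=\sqrt{\frac{\log\rho+b}{C\rho}},\qquad \lambda=\frac{\log\rho+b}{C},\qquad A_{1/r_\rho}=\Big[-\tfrac{1}{2r_\rho},\tfrac{1}{2r_\rho}\Big]^2 ,$$ and let $\mathcal{G}(\mathcal{X}_\lambda,g,A_{1/r_\rho})$ be the random graph whose nodes form a homogeneous Poisson process of density $\lambda$ on the square $A_{1/r_\rho}$ and in which, given the nodes, each pair of distinct nodes at Euclidean distance $x$ is joined by an edge with probability $g(x)$, independently of all other pairs. Then, asymptotically almost surely as $\rho\to\infty$, this graph has no component of finite order $k>1$; that is, for every fixed positive integer $M$, $$\lim_{\rho\to\infty}\Pr\big(\mathcal{G}(\mathcal{X}_\lambda,g,A_{1/r_\rho})\text{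 has no connected component with exactly }k\text{ nodes for any }1<k\le M\big)=1 .$$ -/

import Mathlib

open MeasureTheory Filter Topology
open scoped NNReal ENNReal

/-- The Euclidean plane. -/
abbrev Plane : Type := EuclideanSpace ℝ (Fin 2)

/-- The closed axis-parallel square of side length `s` centred at the origin. -/
def centredSquare (s : ℝ) : Set Plane :=
  {x | ∀ i, x i ∈ Set.Icc (-(s / 2)) (s / 2)}

/-- An outcome of the random network: the number `n` of nodes, the positions of the nodes, and a
mark in `[0, 1]` for every unordered pair of nodes (diagonal marks are never used). -/
abbrev NetworkOutcome : Type :=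
  Σ n : ℕ, (Fin n → Plane) × (Sym2 (Fin n) → unitInterval)

/-- The law of the outcome. The nodes form a homogeneous Poisson process of intensity `d` on the
region `A` of finite area: their number is Poisson with mean `d * area A` and, given that number,
they are independent and uniformly distributed on `A`. The marks of the pairs are independent of
the nodes and of each other, and uniformly distributed on `[0, 1]`. -/
noncomputable def networkLaw (d : ℝ≥0) (A : Set Plane) : Measure NetworkOutcome :=
  Measure.sum fun n : ℕ =>
    ProbabilityTheory.poissonMeasure (d * (volume A).toNNReal) {n} •
      ((Measure.pi fun _ : Fin n => ProbabilityTheory.cond (volume : Measure Plane) A).prod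
        (Measure.pi fun _ : Sym2 (Fin n) => (volume : Measure unitInterval))).map (Sigma.mk n)

/-- The graph of the random connection model with connection function `g`: two distinct nodes at
distance `t` are joined iff the mark of the pair is at most `g t`. Hence, given the positions, pairs
at distance `t` are joined with probability `g t`, independently of each other. -/
def connectionGraph (g : ℝ≥0 → unitInterval) (ω : NetworkOutcome) : SimpleGraph (Fin ω.1) where
  Adj i j := i ≠ j ∧ ω.2.2 s(i, j) ≤ g (nndist (ω.2.1 i) (ω.2.1 j))
  symm := ⟨fun i j h => ⟨h.1.symm, by
    rw [Sym2.eq_swap, nndist_comm]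
    exact h.2⟩⟩
  loopless := ⟨fun _ h => h.1 rfl⟩

/-- `C = ∫ g(‖x‖) dx` over the plane. -/
noncomputable def totalConnection (g : ℝ≥0 → unitInterval) : ℝ :=
  ∫ x : Plane, (g ‖x‖₊ : ℝ)

/-- The node density `(log ρ + b) / C`. -/
noncomputable def nodeDensity (g : ℝ≥0 → unitInterval) (b ρ : ℝ) : ℝ :=
  (Real.log ρ + b) / totalConnection g

/-- `r_ρ = √((log ρ + b) / (C ρ))`. -/
noncomputable def criticalRange (g : ℝ≥0 → unitInterval) (b ρ : ℝ) : ℝ :=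
  Real.sqrt ((Real.log ρ + b) / (totalConnection g * ρ))

/-- The law of the network with node density `(log ρ + b) / C` on the square of side `1 / r_ρ`.
(For the small `ρ` with `log ρ + b ≤ 0` it carries no meaning.) -/
noncomputable def finiteNetworkLaw (g : ℝ≥0 → unitInterval) (b ρ : ℝ) : Measure NetworkOutcome :=
  networkLaw (nodeDensity g b ρ).toNNReal (centredSquare (1 / criticalRange g b ρ))

/-! The proof is a first-moment argument. Let d be the node density, L the side of the square, and
V(x) the integral over the square of the probability that a point is joined to at least one of x_0,
..., x_k. A component of k + 1 nodes contains a spanning tree and sends no edge outside, so after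
summation over the Poisson number of nodes the probability that one exists is at most a sum over
trees p of d^(k+1) ∫ ∏ g(edge lengths) exp(-d V(x)) dx over positions in the square
(`networkLaw_exists_component_le`). It suffices that each such `clusterIntegral` tends to 0.

Each tree is rooted at its node of least `coverage` (expected number of neighbours per unit
density). Since max(a, b) = (a + b)/2 + |a - b|/2, V exceeds the coverage of the root by at least
half the `discrepancy` between the root and any other node. Unless the root is near a corner, the
discrepancy is at least a multiple of min(distance, 1) (`exists_le_discrepancy`). Distributing this
gain over the edges (`coverage_add_sum_le`) gives each edge z a factor exp(-c'd min(‖z‖, 1)), and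
with it an edge contributes O(1/d) rather than the d C it would contribute without it.

What remains is the root integral d ∫ exp(-d coverage), the expected number of isolated nodes. When
d L² ≤ B e^(dC) it is O(√d): bounded from the interior and the corners, of order √d from the sides
(`void_bound_le`). As there is at least one edge, the product is O(1/√d).

The decay of g bounds its integral outside radius w by O(1 / log w). Boundary strips of width w =
e^(ηd) therefore cost only a bounded factor, while a small η keeps their own contribution under
control. Roots near a corner, and squares of side below 2w, which occur when b grows fast, are
treated by crude lower bounds on the coverage. -/

/-! ### Spanning trees and cluster events -/

/-- A subset of a connected component of a graph can be enumerated along a tree: every vertex after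
the first one, which is prescribed, is adjacent to an earlier one. -/
lemma exists_tree_enumeration {V : Type*} [Finite V] (G : SimpleGraph V) (r : V) (k : ℕ)
    (hk : k + 1 ≤ (G.connectedComponentMk r).supp.ncard) :
    ∃ v : Fin (k + 1) → V, Function.Injective v ∧ v 0 = r ∧
      (∀ i, v i ∈ (G.connectedComponentMk r).supp) ∧
      ∃ p : Fin k → Fin (k + 1), (∀ j, p j ≤ j.castSucc) ∧ ∀ j, G.Adj (v j.succ) (v (p j)) := by
  induction k with
  | zero =>
    refine ⟨fun _ => r, fun i j _ => Subsingleton.elim (α := Fin 1) i j, rfl, fun _ => rfl,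
      Fin.elim0, fun j => j.elim0, fun j => j.elim0⟩
  | succ k ih =>
    obtain ⟨v, hv, hv0, hvs, p, hp, hadj⟩ := ih (by omega)
    have hsub : Set.range v ⊆ (G.connectedComponentMk r).supp := by
      rintro _ ⟨i, rfl⟩; exact hvs i
    have hcard : (Set.range v).ncard = k + 1 := by
      rw [← Nat.card_coe_set_eq, Nat.card_congr (Equiv.ofInjective v hv).symm]; simp
    obtain ⟨w, hw, hwv⟩ : ∃ w ∈ (G.connectedComponentMk r).supp, w ∉ Set.range v := by
      by_contra! hcon
      have := Set.ncard_le_ncard (s := (G.connectedComponentMk r).supp) (t := Set.range v)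
        hcon (Set.toFinite _)
      omega
    have hreach : G.Reachable r w := by
      rw [SimpleGraph.ConnectedComponent.mem_supp_iff, SimpleGraph.ConnectedComponent.eq] at hw
      exact hw.symm
    obtain ⟨walk⟩ := hreach
    -- A walk from the root to a vertex not yet listed must leave the listed set along some edge;
    -- its outer end is the next vertex and its inner end the parent.
    obtain ⟨d, -, hd1, hd2⟩ := walk.exists_boundary_dart (Set.range v) ⟨0, hv0⟩ hwv
    obtain ⟨i, hi⟩ := hd1
    have hds : d.snd ∈ (G.connectedComponentMk r).supp := by
      have h1 := hvs i
      rw [SimpleGraph.ConnectedComponent.mem_supp_iff] at h1 ⊢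
      rw [← h1, SimpleGraph.ConnectedComponent.eq, hi]
      exact d.adj.symm.reachable
    refine ⟨Fin.snoc v d.snd, ?_, ?_, ?_, Fin.snoc (fun j => (p j).castSucc) i.castSucc, ?_, ?_⟩
    · rw [Fin.snoc_injective_iff]
      exact ⟨hv, hd2⟩
    · have : (0 : Fin (k + 1 + 1)) = (0 : Fin (k + 1)).castSucc := rfl
      rw [this, Fin.snoc_castSucc, hv0]
    · intro j
      refine Fin.lastCases ?_ (fun j => ?_) j
      · rw [Fin.snoc_last]; exact hds
      · rw [Fin.snoc_castSucc]; exact hvs j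
    · intro j
      refine Fin.lastCases ?_ (fun j => ?_) j
      · rw [Fin.snoc_last]; exact Fin.castSucc_le_castSucc_iff.2 (Fin.le_last i)
      · rw [Fin.snoc_castSucc]; exact Fin.castSucc_le_castSucc_iff.2 (hp j)
    · intro j
      refine Fin.lastCases ?_ (fun j => ?_) j
      · rw [Fin.snoc_last, Fin.succ_last, Fin.snoc_last, Fin.snoc_castSucc, hi]
        exact d.adj.symm
      · rw [Fin.snoc_castSucc, Fin.succ_castSucc, Fin.snoc_castSucc, Fin.snoc_castSucc]
        exact hadj j

/-- The event that the nodes `v 0, …, v k` are joined along the tree `p`, that no other node is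
joined to them, and that `v 0` minimizes the score `S` among them. -/
def clusterEvent (g : ℝ≥0 → unitInterval) (S : Plane → ℝ) {ι : Type*} {k : ℕ}
    (v : Fin (k + 1) → ι) (p : Fin k → Fin (k + 1)) :
    Set ((ι → Plane) × (Sym2 ι → unitInterval)) :=
  {q | (∀ j, S (q.1 (v 0)) ≤ S (q.1 (v j))) ∧
    (∀ j : Fin k, q.2 s(v j.succ, v (p j)) ≤ g (nndist (q.1 (v j.succ)) (q.1 (v (p j))))) ∧
    ∀ y, y ∉ Set.range v → ∀ i, ¬ q.2 s(v i, y) ≤ g (nndist (q.1 (v i)) (q.1 y))}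

lemma measurableSet_clusterEvent {g : ℝ≥0 → unitInterval} (hg : Measurable g) {S : Plane → ℝ}
    (hS : Measurable S) {ι : Type*} [Countable ι] {k : ℕ}
    (v : Fin (k + 1) → ι) (p : Fin k → Fin (k + 1)) : MeasurableSet (clusterEvent g S v p) := by
  have key : ∀ a b : ι, MeasurableSet {q : (ι → Plane) × (Sym2 ι → unitInterval) |
      q.2 s(a, b) ≤ g (nndist (q.1 a) (q.1 b))} := by
    intro a b
    apply measurableSet_le
    · exact (measurable_pi_apply _).comp measurable_snd
    · exact hg.comp (((measurable_pi_apply a).comp measurable_fst).nndist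
        ((measurable_pi_apply b).comp measurable_fst))
  have hset : clusterEvent g S v p =
      (⋂ j, {q | S (q.1 (v 0)) ≤ S (q.1 (v j))}) ∩
      ((⋂ j : Fin k, {q | q.2 s(v j.succ, v (p j)) ≤
        g (nndist (q.1 (v j.succ)) (q.1 (v (p j))))}) ∩
      ⋂ y, ⋂ (_ : y ∉ Set.range v), ⋂ i, {q | q.2 s(v i, y) ≤
        g (nndist (q.1 (v i)) (q.1 y))}ᶜ) := by
    ext q
    simp only [clusterEvent, Set.mem_inter_iff, Set.mem_iInter, Set.mem_compl_iff]
    rfl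
  rw [hset]
  refine MeasurableSet.inter ?_ (MeasurableSet.inter ?_ ?_)
  · refine MeasurableSet.iInter fun j => measurableSet_le ?_ ?_
    · exact hS.comp ((measurable_pi_apply _).comp measurable_fst)
    · exact hS.comp ((measurable_pi_apply _).comp measurable_fst)
  · exact MeasurableSet.iInter fun j => key _ _
  · exact MeasurableSet.iInter fun y => MeasurableSet.iInter fun _ =>
      MeasurableSet.iInter fun i => (key _ _).compl

/-- A component of moderate size forces a cluster event. -/
lemma exists_clusterEvent (g : ℝ≥0 → unitInterval) (S : Plane → ℝ) (ω : NetworkOutcome) (M : ℕ)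
    (c : (connectionGraph g ω).ConnectedComponent) (hc : 1 < c.supp.ncard)
    (hcM : c.supp.ncard ≤ M) :
    ∃ k ∈ Finset.Ico 1 M, ∃ v : Fin (k + 1) → Fin ω.1, Function.Injective v ∧
      ∃ p : Fin k → Fin (k + 1), (∀ j, p j ≤ j.castSucc) ∧ ω.2 ∈ clusterEvent g S v p := by
  obtain ⟨r, hr, hmin⟩ := Set.exists_min_image c.supp (fun i => S (ω.2.1 i)) (Set.toFinite _)
    c.nonempty_supp
  have hrc : (connectionGraph g ω).connectedComponentMk r = c := hr
  obtain ⟨k, hk⟩ : ∃ k, c.supp.ncard = k + 1 := ⟨c.supp.ncard - 1, by omega⟩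
  obtain ⟨v, hv, hv0, hvs, p, hp, hadj⟩ := exists_tree_enumeration (connectionGraph g ω) r k
    (by rw [hrc, hk])
  rw [hrc] at hvs
  -- The enumeration has as many vertices as the component, so it exhausts it; hence no node outside
  -- `Set.range v` is adjacent to it.
  have hrange : Set.range v = c.supp := by
    apply Set.eq_of_subset_of_ncard_le
    · rintro _ ⟨i, rfl⟩; exact hvs i
    · rw [hk, ← Nat.card_coe_set_eq (Set.range v),
        Nat.card_congr (Equiv.ofInjective v hv).symm]; simp
    · exact Set.toFinite _
  refine ⟨k, Finset.mem_Ico.2 ⟨by omega, by omega⟩, v, hv, p, hp, ?_, ?_, ?_⟩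
  · intro j; rw [hv0]; exact hmin _ (hvs j)
  · intro j; exact (hadj j).2
  · intro y hy i hle
    apply hy
    rw [hrange]
    have hne : v i ≠ y := fun h => hy ⟨i, h⟩
    have hA : (connectionGraph g ω).Adj (v i) y := ⟨hne, hle⟩
    have h1 := hvs i
    rw [SimpleGraph.ConnectedComponent.mem_supp_iff] at h1 ⊢
    rw [← h1, SimpleGraph.ConnectedComponent.eq]
    exact hA.symm.reachable

/-! ### Probability of a cluster event for a fixed number of nodes -/

/-- The probability, over independent uniform marks, of a prescribed tree without further edges
leaving it. -/
lemma volume_marks_le {ι : Type*} [Fintype ι] [DecidableEq ι] (a : Sym2 ι → unitInterval) {k : ℕ}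
    {v : Fin (k + 1) → ι} (hv : Function.Injective v) {p : Fin k → Fin (k + 1)}
    (hp : ∀ j, p j ≤ j.castSucc) :
    Measure.pi (fun _ : Sym2 ι => (volume : Measure unitInterval))
      {m | (∀ j : Fin k, m s(v j.succ, v (p j)) ≤ a s(v j.succ, v (p j))) ∧
        ∀ y, y ∉ Set.range v → ∀ i, ¬ m s(v i, y) ≤ a s(v i, y)} ≤
    (∏ j : Fin k, ENNReal.ofReal (a s(v j.succ, v (p j)))) *
      ∏ y : {y // y ∉ Set.range v}, ∏ i, ENNReal.ofReal (1 - a s(v i, (y : ι))) := by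
  classical
  set e₁ : Fin k → Sym2 ι := fun j => s(v j.succ, v (p j)) with he₁
  set e₂ : {y // y ∉ Set.range v} × Fin (k + 1) → Sym2 ι := fun q => s(v q.2, (q.1 : ι)) with he₂
  have hplt : ∀ j : Fin k, p j < j.succ := fun j => lt_of_le_of_lt (hp j) (Fin.castSucc_lt_succ)
  -- Parents precede children, so two tree edges cannot agree with their ends swapped: that would
  -- give `p i < i.succ = p j < j.succ = p i`.
  have inj₁ : Function.Injective e₁ := by
    intro i j hij
    simp only [he₁, Sym2.eq_iff] at hij
    rcases hij with ⟨h, -⟩ | ⟨h1, h2⟩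
    · exact Fin.succ_injective _ (hv h)
    · have h3 := hplt i
      rw [hv h2] at h3
      have h4 := hplt j
      rw [← hv h1] at h4
      exact absurd h3 h4.asymm
  have inj₂ : Function.Injective e₂ := by
    rintro ⟨⟨y, hy⟩, i⟩ ⟨⟨z, hz⟩, j⟩ h
    simp only [he₂, Sym2.eq_iff] at h
    rcases h with ⟨h1, h2⟩ | ⟨h1, h2⟩
    · have := hv h1
      subst this; subst h2; rfl
    · exact absurd ⟨i, h1⟩ hz
  have hdisj : ∀ j q, e₁ j ≠ e₂ q := by
    rintro j ⟨⟨y, hy⟩, i⟩ h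
    simp only [he₁, he₂, Sym2.eq_iff] at h
    rcases h with ⟨h1, h2⟩ | ⟨h1, h2⟩
    · exact hy ⟨_, h2⟩
    · exact hy ⟨_, h1⟩
  set E₁ := Finset.univ.image e₁
  set E₂ := Finset.univ.image e₂
  have hE : Disjoint E₁ E₂ := by
    rw [Finset.disjoint_left]
    intro e h1 h2
    simp only [E₁, E₂, Finset.mem_image, Finset.mem_univ, true_and] at h1 h2
    obtain ⟨j, rfl⟩ := h1
    obtain ⟨q, hq⟩ := h2
    exact hdisj j q hq.symm
  -- The tree pairs and the outgoing pairs are distinct coordinates, so the event lies in a product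
  -- set, whose measure is a product.
  let T : Sym2 ι → Set unitInterval := fun e =>
    if e ∈ E₁ then Set.Iic (a e) else if e ∈ E₂ then Set.Ioi (a e) else Set.univ
  have hsub : {m : Sym2 ι → unitInterval |
      (∀ j : Fin k, m s(v j.succ, v (p j)) ≤ a s(v j.succ, v (p j))) ∧
        ∀ y, y ∉ Set.range v → ∀ i, ¬ m s(v i, y) ≤ a s(v i, y)} ⊆ Set.univ.pi T := by
    rintro m ⟨h1, h2⟩ e -
    simp only [T]
    split_ifs with hh1 hh2
    · simp only [E₁, Finset.mem_image, Finset.mem_univ, true_and] at hh1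
      obtain ⟨j, rfl⟩ := hh1
      exact h1 j
    · simp only [E₂, Finset.mem_image, Finset.mem_univ, true_and] at hh2
      obtain ⟨q, rfl⟩ := hh2
      exact not_le.1 (h2 q.1 q.1.2 q.2)
    · trivial
  refine (measure_mono hsub).trans ?_
  rw [Measure.pi_pi]
  have hvol : ∀ e, volume (T e) = (if e ∈ E₁ then ENNReal.ofReal (a e) else 1) *
      (if e ∈ E₂ then ENNReal.ofReal (1 - a e) else 1) := by
    intro e
    simp only [T]
    split_ifs with h1 h2
    · exact absurd h2 (Finset.disjoint_left.1 hE h1)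
    · simp
    · simp
    · simp
  simp_rw [hvol]
  rw [Finset.prod_mul_distrib, Finset.prod_ite_mem, Finset.prod_ite_mem, Finset.univ_inter,
    Finset.univ_inter, Finset.prod_image inj₁.injOn, Finset.prod_image inj₂.injOn,
    Fintype.prod_prod_type]

lemma lintegral_pi_prod {ι : Type*} [Fintype ι] {X : Type*} [MeasurableSpace X] (ν : Measure X)
    [IsProbabilityMeasure ν] {h : X → ℝ≥0∞} (hh : Measurable h) :
    ∫⁻ x : ι → X, ∏ i, h (x i) ∂(Measure.pi fun _ => ν) = (∫⁻ y, h y ∂ν) ^ Fintype.card ι := by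
  have hind : ProbabilityTheory.iIndepFun (fun (i : ι) (x : ι → X) => h (x i))
      (Measure.pi fun _ => ν) :=
    ProbabilityTheory.iIndepFun_pi (X := fun _ => h) fun _ => hh.aemeasurable
  rw [ProbabilityTheory.lintegral_prod_eq_prod_lintegral_of_indepFun _ _ hind
    (fun i => hh.comp (measurable_pi_apply i))]
  have : ∀ i, ∫⁻ x : ι → X, h (x i) ∂(Measure.pi fun _ => ν) = ∫⁻ y, h y ∂ν := fun i =>
    (measurePreserving_eval (fun _ : ι => ν) i).lintegral_comp hh
  simp [this]

/-- Splitting a family of points into the part indexed by an injective map and the rest preserves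
product measures. -/
lemma measurePreserving_split {ι κ : Type*} [Fintype ι] [Fintype κ] {X : Type*}
    [MeasurableSpace X] (ν : Measure X) [SigmaFinite ν] {v : κ → ι} (hv : Function.Injective v)
    [Fintype {y // y ∉ Set.range v}] :
    MeasurePreserving
      (fun x : ι → X => ((fun j => x (v j)), fun y : {y // y ∉ Set.range v} => x y))
      (Measure.pi fun _ => ν) ((Measure.pi fun _ => ν).prod (Measure.pi fun _ => ν)) := by
  classical
  let e : κ ⊕ {y // y ∉ Set.range v} ≃ ι :=
    (Equiv.sumCongr (Equiv.ofInjective v hv) (Equiv.refl _)).trans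
      (Equiv.sumCompl (fun y => y ∈ Set.range v))
  have h1 := (measurePreserving_piCongrLeft (α := fun _ : ι => X) (fun _ => ν) e).symm
  have h2 := measurePreserving_sumPiEquivProdPi
    (X := fun _ : κ ⊕ {y // y ∉ Set.range v} => X) (fun _ => ν)
  exact h2.comp h1

/-- The tree weight of a configuration of points, on the configurations whose first point minimizes
the score. -/
noncomputable def treeWeight (g : ℝ≥0 → unitInterval) (S : Plane → ℝ) {k : ℕ}
    (p : Fin k → Fin (k + 1)) (x : Fin (k + 1) → Plane) : ℝ≥0∞ :=
  {x : Fin (k + 1) → Plane | ∀ j, S (x 0) ≤ S (x j)}.indicator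
    (fun x => ∏ j : Fin k, ENNReal.ofReal (g (nndist (x j.succ) (x (p j))))) x

/-- The probability that a random point is joined to none of the points `x i`. -/
noncomputable def avoidance (g : ℝ≥0 → unitInterval) (ν : Measure Plane) {k : ℕ}
    (x : Fin (k + 1) → Plane) : ℝ≥0∞ :=
  ∫⁻ y, ∏ i, ENNReal.ofReal (1 - g (nndist (x i) y)) ∂ν

lemma measurable_treeWeight {g : ℝ≥0 → unitInterval} (hg : Measurable g) {S : Plane → ℝ}
    (hS : Measurable S) {k : ℕ} (p : Fin k → Fin (k + 1)) : Measurable (treeWeight g S p) := by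
  refine Measurable.indicator ?_ ?_
  · refine Finset.measurable_prod _ fun j _ => ?_
    refine ENNReal.measurable_ofReal.comp (measurable_subtype_coe.comp (hg.comp ?_))
    exact (measurable_pi_apply _).nndist (measurable_pi_apply _)
  · have : {x : Fin (k + 1) → Plane | ∀ j, S (x 0) ≤ S (x j)} =
        ⋂ j, {x | S (x 0) ≤ S (x j)} := by ext x; simp
    rw [this]
    exact MeasurableSet.iInter fun j => measurableSet_le (hS.comp (measurable_pi_apply _))
      (hS.comp (measurable_pi_apply _))

lemma measurable_avoidance_integrand {g : ℝ≥0 → unitInterval} (hg : Measurable g) {k : ℕ} :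
    Measurable fun q : (Fin (k + 1) → Plane) × Plane =>
      ∏ i, ENNReal.ofReal (1 - g (nndist (q.1 i) q.2)) := by
  refine Finset.measurable_prod _ fun i _ => ?_
  refine ENNReal.measurable_ofReal.comp
    (measurable_const.sub (measurable_subtype_coe.comp (hg.comp ?_)))
  exact ((measurable_pi_apply i).comp measurable_fst).nndist measurable_snd

lemma measurable_avoidance {g : ℝ≥0 → unitInterval} (hg : Measurable g) (ν : Measure Plane)
    [SFinite ν] {k : ℕ} : Measurable (avoidance g ν : (Fin (k + 1) → Plane) → ℝ≥0∞) :=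
  (measurable_avoidance_integrand hg).lintegral_prod_right'

lemma avoidance_le_one (g : ℝ≥0 → unitInterval) (ν : Measure Plane) [IsProbabilityMeasure ν]
    {k : ℕ} (x : Fin (k + 1) → Plane) : avoidance g ν x ≤ 1 := by
  calc avoidance g ν x ≤ ∫⁻ _, 1 ∂ν := by
        refine lintegral_mono fun y => Finset.prod_le_one' fun i _ => ?_
        rw [ENNReal.ofReal_le_one]
        linarith [(g (nndist (x i) y)).2.1]
    _ = 1 := by simp

/-- Given the points indexed by `v`, the other points are still independent with law `ν`, so each
contributes the same factor `∫⁻ y, H x y ∂ν`. -/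
lemma lintegral_mul_prod_compl_range {ι κ : Type*} [Fintype ι] [Fintype κ] {X : Type*}
    [MeasurableSpace X] (ν : Measure X) [IsProbabilityMeasure ν] {v : κ → ι}
    (hv : Function.Injective v) [Fintype {y // y ∉ Set.range v}] {W : (κ → X) → ℝ≥0∞}
    (hW : Measurable W) {H : (κ → X) → X → ℝ≥0∞}
    (hH : Measurable fun q : (κ → X) × X => H q.1 q.2) :
    ∫⁻ x : ι → X, W (fun j => x (v j)) * ∏ y : {y // y ∉ Set.range v}, H (fun j => x (v j)) (x y)
      ∂(Measure.pi fun _ => ν) =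
    ∫⁻ x, W x * (∫⁻ y, H x y ∂ν) ^ (Fintype.card ι - Fintype.card κ)
      ∂(Measure.pi fun _ => ν) := by
  classical
  have hH' : ∀ y : {y // y ∉ Set.range v},
      Measurable fun z : (κ → X) × ({y // y ∉ Set.range v} → X) => H z.1 (z.2 y) := fun y =>
    hH.comp (g := fun q : (κ → X) × X => H q.1 q.2)
      (f := fun z : (κ → X) × ({y // y ∉ Set.range v} → X) => (z.1, z.2 y))
      (measurable_fst.prodMk ((measurable_pi_apply y).comp measurable_snd))
  have hΦ : Measurable fun z : (κ → X) × ({y // y ∉ Set.range v} → X) =>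
      W z.1 * ∏ y, H z.1 (z.2 y) :=
    (hW.comp measurable_fst).mul (Finset.measurable_prod _ fun y _ => hH' y)
  rw [(measurePreserving_split ν hv).lintegral_comp hΦ, lintegral_prod _ hΦ.aemeasurable]
  refine lintegral_congr fun x => ?_
  have hHx : Measurable (H x) := hH.of_uncurry_left (x := x)
  simp only
  have hprod : Measurable fun w : {y // y ∉ Set.range v} → X => ∏ y, H x (w y) :=
    Finset.measurable_prod _ fun y _ => hHx.comp (measurable_pi_apply y)
  rw [lintegral_const_mul _ hprod, lintegral_pi_prod ν hHx]
  congr 2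
  rw [Fintype.card_subtype_compl]
  congr 1
  rw [← Nat.card_eq_fintype_card (α := {y // y ∈ Set.range v}),
    Nat.card_congr (Equiv.ofInjective v hv).symm]
  simp

/-- Fubini: with the positions frozen the marks are integrated by `volume_marks_le`; then the
positions of the nodes outside the cluster are integrated out. -/
lemma measure_clusterEvent_le {g : ℝ≥0 → unitInterval} (hg : Measurable g) {S : Plane → ℝ}
    (hS : Measurable S) {ι : Type*} [Fintype ι] (ν : Measure Plane) [IsProbabilityMeasure ν]
    {k : ℕ} {v : Fin (k + 1) → ι} (hv : Function.Injective v) {p : Fin k → Fin (k + 1)}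
    (hp : ∀ j, p j ≤ j.castSucc) :
    ((Measure.pi fun _ : ι => ν).prod
      (Measure.pi fun _ : Sym2 ι => (volume : Measure unitInterval))) (clusterEvent g S v p) ≤
    ∫⁻ x, treeWeight g S p x * avoidance g ν x ^ (Fintype.card ι - (k + 1))
      ∂(Measure.pi fun _ => ν) := by
  classical
  rw [Measure.prod_apply (measurableSet_clusterEvent hg hS v p)]
  have hsec : ∀ x : ι → Plane, (Measure.pi fun _ : Sym2 ι => (volume : Measure unitInterval))
      (Prod.mk x ⁻¹' clusterEvent g S v p) ≤
      treeWeight g S p (fun j => x (v j)) * ∏ y : {y // y ∉ Set.range v},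
        ∏ i, ENNReal.ofReal (1 - g (nndist (x (v i)) (x y))) := by
    intro x
    by_cases hx : ∀ j, S (x (v 0)) ≤ S (x (v j))
    · let a : Sym2 ι → unitInterval := Sym2.lift ⟨fun i j => g (nndist (x i) (x j)),
        fun i j => by simp only [nndist_comm]⟩
      have ha : ∀ i j, a s(i, j) = g (nndist (x i) (x j)) := fun i j => rfl
      have hvol := volume_marks_le a hv hp
      simp only [ha] at hvol
      refine (measure_mono ?_).trans (hvol.trans (le_of_eq ?_))
      · rintro m ⟨-, h2, h3⟩
        exact ⟨h2, h3⟩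
      · unfold treeWeight
        rw [Set.indicator_of_mem (show (fun j => x (v j)) ∈ {x : Fin (k + 1) → Plane |
          ∀ j, S (x 0) ≤ S (x j)} from hx)]
    · have : Prod.mk x ⁻¹' clusterEvent g S v p = ∅ := by
        ext m
        simp only [Set.mem_preimage, Set.mem_empty_iff_false, iff_false]
        exact fun h => hx h.1
      rw [this]; simp
  refine (lintegral_mono hsec).trans (le_of_eq ?_)
  have := lintegral_mul_prod_compl_range ν hv (measurable_treeWeight hg hS p)
    (H := fun x y => ∏ i, ENNReal.ofReal (1 - g (nndist (x i) y)))
    (measurable_avoidance_integrand hg)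
  rw [Fintype.card_fin] at this
  exact this

/-! ### Poisson summation, the first-moment bound and tree integrals -/

/-- The factorial moments of the Poisson law, weighted by a power. -/
lemma tsum_poisson_descFactorial (r : ℝ≥0) (K : ℕ) {t : ℝ} (ht : 0 ≤ t) :
    ∑' n : ℕ, ProbabilityTheory.poissonMeasure r {n} *
      ((n.descFactorial K : ℝ≥0∞) * ENNReal.ofReal t ^ (n - K)) =
      ENNReal.ofReal ((r : ℝ) ^ K * Real.exp (-(r * (1 - t)))) := by
  -- The terms with n < K vanish because the descending factorial does; shifting n by K leaves an
  -- exponential series.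
  rw [← ENNReal.summable.sum_add_tsum_nat_add' (k := K)]
  rw [Finset.sum_eq_zero, zero_add]
  · have hs := (NormedSpace.expSeries_div_hasSum_exp ((r : ℝ) * t)).mul_left
      ((r : ℝ) ^ K * Real.exp (-r))
    have hval : (r : ℝ) ^ K * Real.exp (-(r * (1 - t))) =
        ∑' n : ℕ, (r : ℝ) ^ K * Real.exp (-r) * ((r * t) ^ n / n.factorial) := by
      rw [hs.tsum_eq, ← Real.exp_eq_exp_ℝ, mul_assoc, ← Real.exp_add]
      congr 2; ring
    rw [hval, ENNReal.ofReal_tsum_of_nonneg (fun n => by positivity) hs.summable]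
    refine tsum_congr fun m => ?_
    rw [ProbabilityTheory.poissonMeasure_singleton, ← ENNReal.ofReal_natCast,
      ← ENNReal.ofReal_pow ht, ← ENNReal.ofReal_mul (by positivity),
      ← ENNReal.ofReal_mul (by positivity)]
    congr 1
    rw [Nat.add_sub_cancel]
    have h1 : ((m.factorial : ℝ) * ((m + K).descFactorial K : ℝ)) = (m + K).factorial := by
      have := Nat.factorial_mul_descFactorial (n := m + K) (k := K) (by omega)
      rw [Nat.add_sub_cancel] at this
      exact_mod_cast this
    have h2 : (0 : ℝ) < (m + K).factorial := by positivity
    have h3 : (0 : ℝ) < m.factorial := by positivity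
    rw [← h1] at h2 ⊢
    have h4 : ((m + K).descFactorial K : ℝ) ≠ 0 := by
      intro h; rw [h] at h2; simp at h2
    field_simp
    ring
  · intro n hn
    rw [Nat.descFactorial_of_lt (Finset.mem_range.1 hn)]
    simp

/-- The outcome with `n` nodes and the given positions and marks. -/
abbrev outcomeMk (n : ℕ) (q : (Fin n → Plane) × (Sym2 (Fin n) → unitInterval)) : NetworkOutcome :=
  ⟨n, q⟩

lemma measurableSet_networkOutcome {s : Set NetworkOutcome}
    (hs : ∀ n, MeasurableSet (outcomeMk n ⁻¹' s)) : MeasurableSet s := by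
  refine MeasurableSpace.measurableSet_iInf.2 fun n => ?_
  exact hs n

lemma networkLaw_apply (d : ℝ≥0) (A : Set Plane) {s : Set NetworkOutcome} (hs : MeasurableSet s) :
    networkLaw d A s = ∑' n, ProbabilityTheory.poissonMeasure (d * (volume A).toNNReal) {n} *
      ((Measure.pi fun _ : Fin n => ProbabilityTheory.cond (volume : Measure Plane) A).prod
        (Measure.pi fun _ : Sym2 (Fin n) => (volume : Measure unitInterval)))
        (outcomeMk n ⁻¹' s) := by
  rw [networkLaw, Measure.sum_apply _ hs]
  refine tsum_congr fun n => ?_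
  have hm : Measurable (outcomeMk n) := by
    intro t ht
    exact (MeasurableSpace.measurableSet_iInf.1 ht) n
  rw [Measure.smul_apply, Measure.map_apply hm hs, smul_eq_mul]

/-- The Poisson weights add up to 1. This total mass is what converts the bound on the bad event
into a limit for its complement. -/
lemma networkLaw_univ (d : ℝ≥0) {A : Set Plane} (h0 : volume A ≠ 0)
    (htop : volume A ≠ ∞) : networkLaw d A Set.univ = 1 := by
  have : IsProbabilityMeasure (ProbabilityTheory.cond (volume : Measure Plane) A) :=
    ProbabilityTheory.cond_isProbabilityMeasure_of_finite h0 htop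
  rw [networkLaw_apply _ _ MeasurableSet.univ]
  simp only [Set.preimage_univ, measure_univ, mul_one]
  have := lintegral_countable' (μ := ProbabilityTheory.poissonMeasure (d * (volume A).toNNReal))
    (fun _ => (1 : ℝ≥0∞))
  simpa using this.symm

/-- The first-moment bound on the probability that the network has a component of order between
`2` and `M`. -/
lemma networkLaw_exists_component_le {g : ℝ≥0 → unitInterval} (hg : Measurable g) {S : Plane → ℝ}
    (hS : Measurable S) (d : ℝ≥0) {A : Set Plane} (h0 : volume A ≠ 0)
    (htop : volume A ≠ ∞) (M : ℕ) :
    networkLaw d A {ω | ∃ c : (connectionGraph g ω).ConnectedComponent,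
      1 < c.supp.ncard ∧ c.supp.ncard ≤ M} ≤
    ∑ k ∈ Finset.Ico 1 M, ∑ p : {p : Fin k → Fin (k + 1) // ∀ j, p j ≤ j.castSucc},
      ∫⁻ x, treeWeight g S p.1 x *
        ENNReal.ofReal ((d * (volume A).toNNReal : ℝ≥0) ^ (k + 1) *
          Real.exp (-((d * (volume A).toNNReal : ℝ≥0) *
            (1 - (avoidance g (ProbabilityTheory.cond volume A) x).toReal))))
        ∂(Measure.pi fun _ => ProbabilityTheory.cond (volume : Measure Plane) A) := by
  set ν := ProbabilityTheory.cond (volume : Measure Plane) A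
  have hν : IsProbabilityMeasure ν := ProbabilityTheory.cond_isProbabilityMeasure_of_finite h0 htop
  set r := d * (volume A).toNNReal
  let E : (n : ℕ) → (k : ℕ) → (Fin (k + 1) ↪ Fin n) →
      {p : Fin k → Fin (k + 1) // ∀ j, p j ≤ j.castSucc} →
      Set ((Fin n → Plane) × (Sym2 (Fin n) → unitInterval)) := fun n k v p =>
    clusterEvent g S v p.1
  have hE : ∀ n k v p, MeasurableSet (E n k v p) := fun n k v p =>
    measurableSet_clusterEvent hg hS _ _
  -- A measurable superset of the component event, so the measurability of the latter is not needed.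
  let B : Set NetworkOutcome := {ω | ω.2 ∈ ⋃ k ∈ Finset.Ico 1 M, ⋃ v, ⋃ p, E ω.1 k v p}
  have hBn : ∀ n, outcomeMk n ⁻¹' B = ⋃ k ∈ Finset.Ico 1 M, ⋃ v, ⋃ p, E n k v p := fun n => rfl
  have hB : MeasurableSet B := by
    refine measurableSet_networkOutcome fun n => ?_
    rw [hBn]
    exact Finset.measurableSet_biUnion _ fun k _ => MeasurableSet.iUnion fun v =>
      MeasurableSet.iUnion fun p => hE n k v p
  have hsub : {ω | ∃ c : (connectionGraph g ω).ConnectedComponent,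
      1 < c.supp.ncard ∧ c.supp.ncard ≤ M} ⊆ B := by
    rintro ω ⟨c, hc, hcM⟩
    obtain ⟨k, hk, v, hv, p, hp, hmem⟩ := exists_clusterEvent g S ω M c hc hcM
    simp only [B, Set.mem_ofPred_eq, Set.mem_iUnion]
    exact ⟨k, hk, ⟨v, hv⟩, ⟨p, hp⟩, hmem⟩
  have hI : ∀ (k : ℕ) (p : {p : Fin k → Fin (k + 1) // ∀ j, p j ≤ j.castSucc}) (n : ℕ),
      Measurable fun x => treeWeight g S p.1 x * avoidance g ν x ^ (n - (k + 1)) := fun k p n =>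
    (measurable_treeWeight hg hS p.1).mul ((measurable_avoidance hg ν).pow_const _)
  calc networkLaw d A _ ≤ networkLaw d A B := measure_mono hsub
    _ ≤ ∑' n, ∑ k ∈ Finset.Ico 1 M,
          ∑ p : {p : Fin k → Fin (k + 1) // ∀ j, p j ≤ j.castSucc},
          ∫⁻ x, treeWeight g S p.1 x * (ProbabilityTheory.poissonMeasure r {n} *
          ((n.descFactorial (k + 1) : ℝ≥0∞) * avoidance g ν x ^ (n - (k + 1))))
            ∂(Measure.pi fun _ => ν) := by
        rw [networkLaw_apply _ _ hB]
        refine ENNReal.tsum_le_tsum fun n => ?_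
        rw [hBn]
        calc _ ≤ ProbabilityTheory.poissonMeasure r {n} *
              ∑ k ∈ Finset.Ico 1 M, ∑ v : Fin (k + 1) ↪ Fin n,
              ∑ p : {p : Fin k → Fin (k + 1) // ∀ j, p j ≤ j.castSucc},
              ∫⁻ x, treeWeight g S p.1 x * avoidance g ν x ^ (n - (k + 1))
                ∂(Measure.pi fun _ => ν) := by
              gcongr
              refine (measure_biUnion_finset_le _ _).trans (Finset.sum_le_sum fun k _ => ?_)
              refine (measure_iUnion_fintype_le _ _).trans (Finset.sum_le_sum fun v _ => ?_)
              refine (measure_iUnion_fintype_le _ _).trans (Finset.sum_le_sum fun p _ => ?_)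
              have := measure_clusterEvent_le hg hS ν v.injective p.2
              rw [Fintype.card_fin] at this
              exact this
          _ = _ := by
              rw [Finset.mul_sum]
              refine Finset.sum_congr rfl fun k _ => ?_
              -- The bound is the same for every embedding `v`, and there are `n.descFactorial (k +
              -- 1)` of them: this produces the factorial moment.
              rw [Finset.sum_const, Finset.card_univ, Fintype.card_embedding_eq, Fintype.card_fin,
                Fintype.card_fin, nsmul_eq_mul, Finset.mul_sum, Finset.mul_sum]
              refine Finset.sum_congr rfl fun p _ => ?_
              rw [← lintegral_const_mul _ (hI k p n), ← lintegral_const_mul _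
                ((hI k p n).const_mul _)]
              refine lintegral_congr fun x => ?_
              ring
    _ = ∑ k ∈ Finset.Ico 1 M, ∑ p : {p : Fin k → Fin (k + 1) // ∀ j, p j ≤ j.castSucc},
          ∫⁻ x, ∑' n, treeWeight g S p.1 x * (ProbabilityTheory.poissonMeasure r {n} *
          ((n.descFactorial (k + 1) : ℝ≥0∞) * avoidance g ν x ^ (n - (k + 1))))
            ∂(Measure.pi fun _ => ν) := by
        rw [Summable.tsum_finsetSum fun _ _ => ENNReal.summable]
        refine Finset.sum_congr rfl fun k _ => ?_
        rw [Summable.tsum_finsetSum fun _ _ => ENNReal.summable]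
        refine Finset.sum_congr rfl fun p _ => ?_
        rw [lintegral_tsum]
        intro n
        exact ((measurable_treeWeight hg hS p.1).mul
          (((measurable_avoidance hg ν).pow_const _).const_mul _ |>.const_mul _)).aemeasurable
    _ = _ := by
        refine Finset.sum_congr rfl fun k _ => Finset.sum_congr rfl fun p _ =>
          lintegral_congr fun x => ?_
        rw [ENNReal.tsum_mul_left, ← tsum_poisson_descFactorial r (k + 1) ENNReal.toReal_nonneg,
          ENNReal.ofReal_toReal ((avoidance_le_one g ν x).trans_lt ENNReal.one_lt_top).ne]

/-- Integrating a product along a tree, leaf by leaf. -/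
lemma lintegral_tree_le {X : Type*} [MeasurableSpace X] (ν : Measure X) [SigmaFinite ν]
    {F : X → ℝ≥0∞} (hF : Measurable F) {κ : X → X → ℝ≥0∞}
    (hκ : Measurable fun q : X × X => κ q.1 q.2) {K : ℝ≥0∞} (hK : ∀ y, ∫⁻ z, κ z y ∂ν ≤ K)
    {k : ℕ} (p : Fin k → Fin (k + 1)) (hp : ∀ j, p j ≤ j.castSucc) :
    ∫⁻ x : Fin (k + 1) → X, F (x 0) * ∏ j : Fin k, κ (x j.succ) (x (p j))
      ∂(Measure.pi fun _ => ν) ≤ (∫⁻ y, F y ∂ν) * K ^ k := by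
  induction k with
  | zero =>
    have h := (measurePreserving_piUnique (fun _ : Fin 1 => ν)).lintegral_comp hF
    simp only [Finset.univ_eq_empty, Finset.prod_empty, mul_one, pow_zero]
    exact h.le
  | succ k ih =>
    have hlt : ∀ j : Fin k, (p j.castSucc).val < k + 1 := fun j =>
      lt_of_le_of_lt (Fin.le_def.1 (hp j.castSucc)) (by simp)
    let p' : Fin k → Fin (k + 1) := fun j => (p j.castSucc).castLT (hlt j)
    have hp' : ∀ j, p' j ≤ j.castSucc := fun j => hp j.castSucc
    have hpp : ∀ j : Fin k, p j.castSucc = (p' j).castSucc := fun j => by simp [p']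
    let l : Fin (k + 1) := (p (Fin.last k)).castLT (lt_of_le_of_lt (hp (Fin.last k)) (by simp))
    have hl : p (Fin.last k) = l.castSucc := by simp [l]
    -- The last vertex is a leaf, since parents precede children; it is split off and integrated
    -- first, costing a factor at most `K`.
    have hmp := measurePreserving_piFinSuccAbove (fun _ : Fin (k + 2) => ν) (Fin.last (k + 1))
    let Ψ : X × (Fin (k + 1) → X) → ℝ≥0∞ := fun z =>
      (F (z.2 0) * ∏ j : Fin k, κ (z.2 j.succ) (z.2 (p' j))) * κ z.1 (z.2 l)
    have hmeas : Measurable fun w : Fin (k + 1) → X =>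
        F (w 0) * ∏ j : Fin k, κ (w j.succ) (w (p' j)) := by
      refine (hF.comp (measurable_pi_apply 0)).mul (Finset.measurable_prod _ fun j _ => ?_)
      exact hκ.comp (g := fun q : X × X => κ q.1 q.2)
        (f := fun w : Fin (k + 1) → X => (w j.succ, w (p' j)))
        ((measurable_pi_apply _).prodMk (measurable_pi_apply _))
    have hΨ : Measurable Ψ := by
      refine (hmeas.comp measurable_snd).mul ?_
      exact hκ.comp (g := fun q : X × X => κ q.1 q.2)
        (f := fun z : X × (Fin (k + 1) → X) => (z.1, z.2 l))
        (measurable_fst.prodMk ((measurable_pi_apply _).comp measurable_snd))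
    have hint : ∀ x : Fin (k + 2) → X, F (x 0) * ∏ j : Fin (k + 1), κ (x j.succ) (x (p j)) =
        Ψ (MeasurableEquiv.piFinSuccAbove (fun _ => X) (Fin.last (k + 1)) x) := by
      intro x
      simp only [Ψ, Fin.prod_univ_castSucc, hpp, hl, MeasurableEquiv.piFinSuccAbove_apply,
        Fin.insertNthEquiv_symm_apply, Fin.removeNth_last, Fin.init]
      rw [mul_assoc]
      rfl
    calc _ = ∫⁻ z, Ψ z ∂(ν.prod (Measure.pi fun _ => ν)) := by
          rw [← hmp.lintegral_comp hΨ]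
          exact lintegral_congr hint
      _ = ∫⁻ w, ∫⁻ z, Ψ (z, w) ∂ν ∂(Measure.pi fun _ => ν) := lintegral_prod_symm' _ hΨ
      _ ≤ ∫⁻ w : Fin (k + 1) → X,
            (F (w 0) * ∏ j : Fin k, κ (w j.succ) (w (p' j))) * K ∂(Measure.pi fun _ => ν) := by
          refine lintegral_mono fun w => ?_
          simp only [Ψ]
          have hz : Measurable fun z => κ z (w l) := hκ.comp (g := fun q : X × X => κ q.1 q.2)
            (f := fun z : X => (z, w l)) (measurable_id.prodMk measurable_const)
          rw [lintegral_const_mul _ hz]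
          gcongr
          exact hK _
      _ = (∫⁻ w : Fin (k + 1) → X,
            F (w 0) * ∏ j : Fin k, κ (w j.succ) (w (p' j)) ∂(Measure.pi fun _ => ν)) * K :=
          lintegral_mul_const _ hmeas
      _ ≤ (∫⁻ y, F y ∂ν) * K ^ k * K := by
          gcongr
          exact ih p' hp'
      _ = _ := by rw [pow_succ, mul_assoc]

/-! ### Boxes, reflections and quadrants of the plane -/

/-- The connection probability as a function of the displacement. -/
noncomputable def linkProb (g : ℝ≥0 → unitInterval) (z : Plane) : ℝ := g ‖z‖₊

/-- An open axis-parallel box in the plane. -/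
def openBox (a b : Fin 2 → ℝ) : Set Plane := {z | ∀ i, z i ∈ Set.Ioo (a i) (b i)}

/-- A closed axis-parallel box in the plane. -/
def closedBox (a b : Fin 2 → ℝ) : Set Plane := {z | ∀ i, z i ∈ Set.Icc (a i) (b i)}

lemma openBox_eq_preimage (a b : Fin 2 → ℝ) :
    openBox a b = (WithLp.ofLp : Plane → Fin 2 → ℝ) ⁻¹'
      (Set.univ.pi fun i => Set.Ioo (a i) (b i)) := by
  ext z; simp [openBox]

lemma closedBox_eq_preimage (a b : Fin 2 → ℝ) :
    closedBox a b = (WithLp.ofLp : Plane → Fin 2 → ℝ) ⁻¹'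
      (Set.univ.pi fun i => Set.Icc (a i) (b i)) := by
  ext z; simp only [closedBox, Set.mem_preimage, Set.mem_univ_pi]; rfl

lemma measurableSet_openBox (a b : Fin 2 → ℝ) : MeasurableSet (openBox a b) := by
  rw [openBox_eq_preimage]
  exact (MeasurableSet.univ_pi fun i => measurableSet_Ioo).preimage
    (PiLp.volume_preserving_ofLp (Fin 2)).measurable

lemma measurableSet_closedBox (a b : Fin 2 → ℝ) : MeasurableSet (closedBox a b) := by
  rw [closedBox_eq_preimage]
  exact (MeasurableSet.univ_pi fun i => measurableSet_Icc).preimage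
    (PiLp.volume_preserving_ofLp (Fin 2)).measurable

lemma volume_openBox (a b : Fin 2 → ℝ) :
    volume (openBox a b) = ENNReal.ofReal (b 0 - a 0) * ENNReal.ofReal (b 1 - a 1) := by
  rw [openBox_eq_preimage, (PiLp.volume_preserving_ofLp (Fin 2)).measure_preimage
    (MeasurableSet.univ_pi fun i => measurableSet_Ioo).nullMeasurableSet, volume_pi, Measure.pi_pi]
  simp

lemma volume_closedBox (a b : Fin 2 → ℝ) :
    volume (closedBox a b) = ENNReal.ofReal (b 0 - a 0) * ENNReal.ofReal (b 1 - a 1) := by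
  rw [closedBox_eq_preimage, (PiLp.volume_preserving_ofLp (Fin 2)).measure_preimage
    (MeasurableSet.univ_pi fun i => measurableSet_Icc).nullMeasurableSet, volume_pi, Measure.pi_pi]
  simp

/-- Reflection of the plane in the coordinates marked by `s`. -/
noncomputable def reflection (s : Fin 2 → Bool) : Plane ≃ₗᵢ[ℝ] Plane :=
  LinearIsometryEquiv.piLpCongrRight 2 fun i => if s i then .neg ℝ else .refl ℝ ℝ

lemma reflection_apply (s : Fin 2 → Bool) (z : Plane) (i : Fin 2) :
    reflection s z i = (if s i then -1 else 1) * z i := by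
  simp only [reflection, LinearIsometryEquiv.piLpCongrRight_apply]
  split_ifs <;> simp

section
variable {g : ℝ≥0 → unitInterval}

lemma linkProb_nonneg (z : Plane) : 0 ≤ linkProb g z := (g _).2.1
lemma linkProb_le_one (z : Plane) : linkProb g z ≤ 1 := (g _).2.2
lemma linkProb_anti (hg : Antitone g) {z w : Plane} (h : ‖z‖ ≤ ‖w‖) :
    linkProb g w ≤ linkProb g z := hg (show ‖z‖₊ ≤ ‖w‖₊ from h)
lemma linkProb_neg (z : Plane) : linkProb g (-z) = linkProb g z := by simp [linkProb]
lemma linkProb_sub_comm (z w : Plane) : linkProb g (z - w) = linkProb g (w - z) := by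
  rw [← neg_sub, linkProb_neg]
lemma linkProb_reflection (s : Fin 2 → Bool) (z : Plane) :
    linkProb g (reflection s z) = linkProb g z := by simp [linkProb]
lemma measurable_linkProb (hg : Antitone g) : Measurable (linkProb g) :=
  measurable_subtype_coe.comp (hg.measurable.comp measurable_nnnorm)
lemma totalConnection_eq : totalConnection g = ∫ z, linkProb g z := rfl
lemma integrable_linkProb (hpos : 0 < totalConnection g) : Integrable (linkProb g) := by
  by_contra h
  rw [totalConnection_eq, integral_undef h] at hpos
  exact lt_irrefl _ hpos

lemma integrable_linkProb_sub (hpos : 0 < totalConnection g) (x : Plane) :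
    Integrable fun y => linkProb g (x - y) :=
  (integrable_linkProb hpos).comp_sub_left x

lemma linkProb_le_of_le (hg : Antitone g) {t : ℝ} (ht : 0 ≤ t) {z : Plane} (h : t ≤ ‖z‖) :
    linkProb g z ≤ g t.toNNReal := hg (by
      rw [← NNReal.coe_le_coe, Real.coe_toNNReal _ ht]; exact h)

lemma le_linkProb_of_le (hg : Antitone g) {t : ℝ} {z : Plane} (h : ‖z‖ ≤ t) :
    (g t.toNNReal : ℝ) ≤ linkProb g z := hg (by
      rw [← NNReal.coe_le_coe, Real.coe_toNNReal _ ((norm_nonneg z).trans h)]; exact h)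

/-- The connection function does not vanish near the origin. -/
lemma exists_pos_link (hg : Antitone g) (hpos : 0 < totalConnection g) :
    ∃ R : ℝ, 0 < R ∧ 0 < (g (2 * R).toNNReal : ℝ) := by
  by_contra! hcon
  have hz : ∀ z : Plane, z ≠ 0 → linkProb g z = 0 := by
    intro z hz
    refine le_antisymm ?_ (linkProb_nonneg z)
    have h := hcon (‖z‖ / 2) (by positivity)
    refine le_trans ?_ h
    exact linkProb_le_of_le hg (by positivity) (by linarith)
  have h0 : ∫ z, linkProb g z = 0 := by
    apply integral_eq_zero_of_ae
    filter_upwards [Measure.ae_ne volume (0 : Plane)] with z h using hz z h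
  rw [totalConnection_eq, h0] at hpos
  exact lt_irrefl _ hpos

end

lemma norm_le_abs_add (z : Plane) : ‖z‖ ≤ |z 0| + |z 1| := by
  rw [EuclideanSpace.norm_eq, Fin.sum_univ_two]
  apply Real.sqrt_le_iff.2
  refine ⟨by positivity, ?_⟩
  simp only [Real.norm_eq_abs]
  nlinarith [abs_nonneg (z 0), abs_nonneg (z 1)]

lemma abs_apply_le_norm (z : Plane) (i : Fin 2) : |z i| ≤ ‖z‖ := PiLp.norm_apply_le z i

/-- The open quadrant of the plane with the signs prescribed by `s`. -/
def quadrant (s : Fin 2 → Bool) : Set Plane := {z | ∀ i, 0 < (if s i then -1 else 1) * z i}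

lemma measurable_plane_apply (i : Fin 2) : Measurable fun z : Plane => z i :=
  (measurable_pi_apply i).comp (PiLp.volume_preserving_ofLp (Fin 2)).measurable

lemma measurableSet_quadrant (s : Fin 2 → Bool) : MeasurableSet (quadrant s) := by
  have : quadrant s = ⋂ i, {z : Plane | 0 < (if s i then -1 else 1) * z i} := by
    ext z; simp [quadrant]
  rw [this]
  exact MeasurableSet.iInter fun i =>
    measurableSet_lt measurable_const ((measurable_plane_apply i).const_mul _)

lemma ae_apply_ne_zero : ∀ᵐ z : Plane, ∀ i, z i ≠ 0 := by
  rw [ae_all_iff]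
  intro i
  have h : ∀ᵐ z : Fin 2 → ℝ, z i ≠ 0 :=
    Measure.ae_eval_ne (μ := fun _ : Fin 2 => (volume : Measure ℝ)) i (0 : ℝ)
  exact (PiLp.volume_preserving_ofLp (Fin 2)).quasiMeasurePreserving.ae h

lemma ae_mem_iUnion_quadrant : ∀ᵐ z : Plane, z ∈ ⋃ s, quadrant s := by
  filter_upwards [ae_apply_ne_zero] with z hz
  refine Set.mem_iUnion.2 ⟨fun i => decide (z i < 0), fun i => ?_⟩
  rcases lt_or_gt_of_ne (hz i) with h | h
  · simp [h]
  · simp [not_lt.2 h.le, h]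

lemma pairwise_disjoint_quadrant : Pairwise (Function.onFun Disjoint quadrant) := by
  intro s t hst
  rw [Function.onFun, Set.disjoint_left]
  intro z hs ht
  apply hst
  funext i
  have h1 := hs i
  have h2 := ht i
  cases hs' : s i <;> cases ht' : t i <;> simp_all <;> linarith

/-- The four open quadrants are disjoint and miss only the coordinate axes, which are null. -/
lemma setIntegral_eq_sum_quadrant {h : Plane → ℝ} (hh : Integrable h) {B : Set Plane}
    (hB : MeasurableSet B) : ∫ z in B, h z = ∑ s, ∫ z in B ∩ quadrant s, h z := by
  have hae : B =ᵐ[volume] ⋃ s, B ∩ quadrant s := by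
    rw [← Set.inter_iUnion]
    filter_upwards [ae_mem_iUnion_quadrant] with z hz
    exact propext ⟨fun h => ⟨h, hz⟩, fun h => h.1⟩
  rw [setIntegral_congr_set hae, integral_iUnion_fintype
    (fun s => hB.inter (measurableSet_quadrant s))
    (fun s t hst => (pairwise_disjoint_quadrant hst).mono Set.inter_subset_right
      Set.inter_subset_right) (fun s => hh.integrableOn)]

lemma integral_eq_sum_quadrant {h : Plane → ℝ} (hh : Integrable h) :
    ∫ z, h z = ∑ s, ∫ z in quadrant s, h z := by
  have := setIntegral_eq_sum_quadrant hh MeasurableSet.univ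
  simpa using this

/-! ### Coverage of a point, bounded below by boxes -/

section
variable {g : ℝ≥0 → unitInterval}

lemma setIntegral_linkProb_reflection (s : Fin 2 → Bool) (B : Set Plane) :
    ∫ z in reflection s ⁻¹' B, linkProb g z = ∫ z in B, linkProb g z := by
  have h := (reflection s).measurePreserving.setIntegral_preimage_emb
    (reflection s).toMeasurableEquiv.measurableEmbedding (linkProb g) B
  simpa only [linkProb_reflection] using h

lemma reflection_preimage_quadrant (s : Fin 2 → Bool) :
    reflection s ⁻¹' (quadrant fun _ => false) = quadrant s := by
  ext z
  simp only [quadrant, Set.mem_preimage]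
  refine forall_congr' fun i => ?_
  rw [reflection_apply]
  simp

/-- The integral of the connection probability over an open box with a corner at the origin. -/
noncomputable def boxConnection (g : ℝ≥0 → unitInterval) (a b : ℝ) : ℝ :=
  ∫ z in openBox 0 ![a, b], linkProb g z

/-- The integral of the connection probability outside a disc. -/
noncomputable def tailConnection (g : ℝ≥0 → unitInterval) (w : ℝ) : ℝ :=
  ∫ z in {z : Plane | w ≤ ‖z‖}, linkProb g z

lemma measurableSet_tail (w : ℝ) : MeasurableSet {z : Plane | w ≤ ‖z‖} :=
  measurableSet_le measurable_const measurable_norm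

lemma totalConnection_eq_quadrant (hpos : 0 < totalConnection g) :
    totalConnection g = 4 * ∫ z in quadrant fun _ => false, linkProb g z := by
  rw [totalConnection_eq, integral_eq_sum_quadrant (integrable_linkProb hpos)]
  have : ∀ s, ∫ z in quadrant s, linkProb g z =
      ∫ z in quadrant fun _ => false, linkProb g z := fun s => by
    rw [← reflection_preimage_quadrant s, setIntegral_linkProb_reflection]
  simp [this]

lemma setIntegral_linkProb_mono (hpos : 0 < totalConnection g) {A B : Set Plane} (h : A ⊆ B) :
    ∫ z in A, linkProb g z ≤ ∫ z in B, linkProb g z :=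
  setIntegral_mono_set (integrable_linkProb hpos).integrableOn
    (Eventually.of_forall fun z => linkProb_nonneg z) h.eventuallyLE

lemma boxConnection_nonneg (a b : ℝ) : 0 ≤ boxConnection g a b :=
  integral_nonneg fun z => linkProb_nonneg z

lemma boxConnection_mono (hpos : 0 < totalConnection g) {a b a' b' : ℝ} (ha : a ≤ a')
    (hb : b ≤ b') : boxConnection g a b ≤ boxConnection g a' b' := by
  apply setIntegral_linkProb_mono hpos
  intro z hz i
  have := hz i
  fin_cases i
  · exact ⟨this.1, this.2.trans_le ha⟩
  · exact ⟨this.1, this.2.trans_le hb⟩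

/-- By symmetry a quadrant carries a quarter of the total, and a point of it outside the box has a
coordinate, hence a norm, at least `w`. -/
lemma le_boxConnection (hpos : 0 < totalConnection g) {a b w : ℝ} (ha : w ≤ a) (hb : w ≤ b) :
    totalConnection g / 4 - tailConnection g w ≤ boxConnection g a b := by
  have h1 : ∫ z in quadrant fun _ => false, linkProb g z ≤
      ∫ z in openBox 0 ![a, b] ∪ {z : Plane | w ≤ ‖z‖}, linkProb g z := by
    apply setIntegral_linkProb_mono hpos
    intro z hz
    have h0 := hz 0
    have h1 := hz 1
    simp only [Bool.false_eq_true, if_false, one_mul] at h0 h1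
    by_cases hw : w ≤ ‖z‖
    · exact Or.inr hw
    · left
      push Not at hw
      have := (le_abs_self _).trans (abs_apply_le_norm z 0)
      have := (le_abs_self _).trans (abs_apply_le_norm z 1)
      intro i
      fin_cases i
      · exact ⟨h0, by simp; linarith⟩
      · exact ⟨h1, by simp; linarith⟩
  have h2 : ∫ z in openBox 0 ![a, b] ∪ {z : Plane | w ≤ ‖z‖}, linkProb g z ≤
      boxConnection g a b + tailConnection g w := by
    have hI := integrable_linkProb hpos
    rw [← Set.union_sdiff_self, setIntegral_union Set.disjoint_sdiff_right
      (MeasurableSet.diff (measurableSet_tail w) (measurableSet_openBox _ _))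
      hI.integrableOn hI.integrableOn]
    exact add_le_add le_rfl (setIntegral_linkProb_mono hpos Set.sdiff_subset)
  rw [totalConnection_eq_quadrant hpos]
  linarith

/-- A square of side `R` at the origin lies in the disc of radius `2 * R`, where monotonicity bounds
the connection probability below by g(2R). -/
lemma le_boxConnection_self (hg : Antitone g) (hpos : 0 < totalConnection g) {R : ℝ} (hR : 0 ≤ R) :
    R ^ 2 * g (2 * R).toNNReal ≤ boxConnection g R R := by
  have hvol : (volume (openBox 0 ![R, R])).toReal = R ^ 2 := by
    rw [volume_openBox, ENNReal.toReal_mul]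
    simp [hR, sq]
  have hfin : volume (openBox 0 ![R, R]) ≠ ∞ := by
    rw [volume_openBox]; exact ENNReal.mul_ne_top ENNReal.ofReal_ne_top ENNReal.ofReal_ne_top
  have h := setIntegral_mono_on (s := openBox 0 ![R, R]) (μ := volume)
    (f := fun _ => (g (2 * R).toNNReal : ℝ)) (g := linkProb g)
    (integrableOn_const hfin) (integrable_linkProb hpos).integrableOn
    (measurableSet_openBox _ _) (by
      intro z hz
      apply le_linkProb_of_le hg
      have h0 := hz 0
      have h1 := hz 1
      simp at h0 h1
      have := norm_le_abs_add z
      rw [abs_of_pos h0.1, abs_of_pos h1.1] at this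
      linarith)
  rw [setIntegral_const, smul_eq_mul, measureReal_def, hvol] at h
  exact h

/-- The expected number of neighbours, per unit density, of a point of a square. -/
noncomputable def coverage (g : ℝ≥0 → unitInterval) (L : ℝ) (x : Plane) : ℝ :=
  ∫ y in centredSquare L, linkProb g (x - y)

lemma centredSquare_eq (L : ℝ) :
    centredSquare L = closedBox (fun _ => -(L / 2)) (fun _ => L / 2) := rfl

lemma measurableSet_centredSquare (L : ℝ) : MeasurableSet (centredSquare L) :=
  measurableSet_closedBox _ _

lemma coverage_eq_shift (L : ℝ) (x : Plane) :
    coverage g L x = ∫ z in {z | z + x ∈ centredSquare L}, linkProb g z := by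
  have h := (measurePreserving_add_right (volume : Measure Plane) x).setIntegral_preimage_emb
    (measurableEmbedding_addRight x) (fun y => linkProb g (x - y)) (centredSquare L)
  rw [coverage, ← h]
  refine setIntegral_congr_fun ((measurableSet_centredSquare L).preimage
    (measurable_add_const x)) fun z _ => ?_
  rw [linkProb_sub_comm, add_sub_cancel_right]

/-- Seen from `x`, the square splits into four rectangles, one per quadrant, with sides the
distances from `x` to the sides of the square. Reflections move each to the positive quadrant, so
the coverage near an edge or a corner is controlled by these distances alone. -/
lemma sum_boxConnection_le_coverage (hpos : 0 < totalConnection g) {L : ℝ} {x : Plane}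
    (hx : x ∈ centredSquare L) :
    boxConnection g (L / 2 - x 0) (L / 2 - x 1) + boxConnection g (L / 2 - x 0) (L / 2 + x 1) +
    boxConnection g (L / 2 + x 0) (L / 2 - x 1) + boxConnection g (L / 2 + x 0) (L / 2 + x 1) ≤
    coverage g L x := by
  have hmeas : MeasurableSet {z | z + x ∈ centredSquare L} :=
    (measurableSet_centredSquare L).preimage (measurable_add_const x)
  rw [coverage_eq_shift, setIntegral_eq_sum_quadrant (integrable_linkProb hpos) hmeas]
  have key : ∀ s : Fin 2 → Bool, boxConnection g (L / 2 - (if s 0 then -1 else 1) * x 0)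
      (L / 2 - (if s 1 then -1 else 1) * x 1) ≤
      ∫ z in {z | z + x ∈ centredSquare L} ∩ quadrant s, linkProb g z := by
    intro s
    rw [boxConnection, ← setIntegral_linkProb_reflection s]
    apply setIntegral_linkProb_mono hpos
    intro z hz
    have hz' : ∀ i, 0 < (if s i then -1 else 1) * z i ∧
        (if s i then -1 else 1) * z i < L / 2 - (if s i then -1 else 1) * x i := by
      intro i
      have := hz i
      rw [reflection_apply] at this
      refine ⟨this.1, this.2.trans_le (le_of_eq ?_)⟩
      fin_cases i <;> rfl
    refine ⟨fun i => ?_, fun i => (hz' i).1⟩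
    have h1 := hz' i
    have h2 := hx i
    rw [PiLp.add_apply]
    cases hs : s i <;> simp only [hs, if_true, if_false, Bool.false_eq_true] at h1 <;>
      constructor <;> linarith [h2.1, h2.2, h1.1, h1.2]
  refine le_trans (le_of_eq ?_) (Finset.sum_le_sum fun s _ => key s)
  have h := Fintype.sum_equiv (finTwoArrowEquiv Bool) (fun s : Fin 2 → Bool =>
    boxConnection g (L / 2 - (if s 0 then -1 else 1) * x 0)
      (L / 2 - (if s 1 then -1 else 1) * x 1)) (fun q : Bool × Bool =>
    boxConnection g (L / 2 - (if q.1 then -1 else 1) * x 0)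
      (L / 2 - (if q.2 then -1 else 1) * x 1)) (fun s => rfl)
  rw [h, Fintype.sum_prod_type]
  simp only [Fintype.sum_bool, if_true, Bool.false_eq_true, if_false]
  ring_nf
end

/-! ### Consequences of the decay of the connection function -/

lemma hasDerivAt_neg_inv_log {t : ℝ} (ht : 1 < t) :
    HasDerivAt (fun t => -(Real.log t)⁻¹) (1 / (t * Real.log t ^ 2)) t := by
  have hl : Real.log t ≠ 0 := (Real.log_pos ht).ne'
  have h0 : t ≠ 0 := by positivity
  refine ((Real.hasDerivAt_log h0).inv hl).neg.congr_deriv ?_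
  rw [neg_div, neg_neg, inv_eq_one_div, div_div]

lemma integrableOn_inv_mul_log_sq {w : ℝ} (hw : 1 < w) :
    IntegrableOn (fun t => 1 / (t * Real.log t ^ 2)) (Set.Ioi w) ∧
    ∫ t in Set.Ioi w, 1 / (t * Real.log t ^ 2) = (Real.log w)⁻¹ := by
  have hd : ∀ t ∈ Set.Ici w, HasDerivAt (fun t => -(Real.log t)⁻¹) (1 / (t * Real.log t ^ 2)) t :=
    fun t ht => hasDerivAt_neg_inv_log (hw.trans_le ht)
  have hnn : ∀ t ∈ Set.Ioi w, 0 ≤ 1 / (t * Real.log t ^ 2) := fun t ht => by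
    have : 0 < t := by linarith [Set.mem_Ioi.1 ht]
    positivity
  have hlim : Tendsto (fun t => -(Real.log t)⁻¹) atTop (𝓝 0) := by
    simpa using (tendsto_inv_atTop_zero.comp Real.tendsto_log_atTop).neg
  refine ⟨integrableOn_Ioi_deriv_of_nonneg' hd hnn hlim, ?_⟩
  rw [integral_Ioi_of_hasDerivAt_of_nonneg' hd hnn hlim]
  ring

section
variable {g : ℝ≥0 → unitInterval}

/-- The decay of the connection function bounds its integral outside large discs. -/
lemma exists_tailConnection_le (hg_decay : (fun t : ℝ≥0 => (g t : ℝ)) =o[atTop]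
      fun t : ℝ≥0 => 1 / ((t : ℝ) ^ 2 * Real.log (t : ℝ) ^ 2)) :
    ∃ c w₀ : ℝ, 0 < c ∧ 1 < w₀ ∧ ∀ w, w₀ ≤ w → tailConnection g w ≤ c / Real.log w := by
  have hev := hg_decay.bound one_pos
  obtain ⟨w₁, hw₁⟩ := eventually_atTop.1 hev
  set V := (volume : Measure Plane).real (Metric.ball 0 1)
  -- In polar coordinates the tail is 2V ∫ y g(y) dy, with V the area of the unit disc, and the
  -- integral is at most 1 / log w. The summand 1 makes positivity of the constant immediate; `w ≥
  -- 2` makes the logarithm positive.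
  refine ⟨2 * V + 1, max w₁ 2, by positivity, lt_of_lt_of_le one_lt_two (le_max_right _ _), ?_⟩
  intro w hw
  have hw2 : 1 < w := by linarith [le_max_right (w₁ : ℝ) 2]
  have hww : (w₁ : ℝ) ≤ w := (le_max_left _ _).trans hw
  have hpolar := integral_fun_norm_addHaar (volume : Measure Plane)
    (fun t : ℝ => (Set.Ici w).indicator (fun t => (g t.toNNReal : ℝ)) t)
  have hl : ∫ x : Plane, (Set.Ici w).indicator (fun t => (g t.toNNReal : ℝ)) ‖x‖ =
      tailConnection g w := by
    rw [tailConnection, ← integral_indicator (measurableSet_tail w)]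
    refine integral_congr_ae (Eventually.of_forall fun z => ?_)
    show (Set.Ici w).indicator (fun t => (g t.toNNReal : ℝ)) ‖z‖ = _
    by_cases hz : w ≤ ‖z‖
    · rw [Set.indicator_of_mem (by exact hz), Set.indicator_of_mem (by exact hz), linkProb,
        norm_toNNReal]
    · rw [Set.indicator_of_notMem (by exact hz), Set.indicator_of_notMem (by exact hz)]
  rw [hl, finrank_euclideanSpace, Fintype.card_fin] at hpolar
  rw [hpolar]
  obtain ⟨hint, hval⟩ := integrableOn_inv_mul_log_sq hw2
  have hbd : ∫ y in Set.Ioi (0 : ℝ), y ^ (2 - 1) •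
      (Set.Ici w).indicator (fun t => (g t.toNNReal : ℝ)) y ≤ (Real.log w)⁻¹ := by
    rw [← hval]
    have h1 : ∫ y in Set.Ioi (0 : ℝ), y ^ (2 - 1) •
        (Set.Ici w).indicator (fun t => (g t.toNNReal : ℝ)) y =
        ∫ y in Set.Ioi w, y * (g y.toNNReal : ℝ) := by
      rw [← integral_Ici_eq_integral_Ioi (x := w), ← integral_indicator measurableSet_Ici,
        ← integral_indicator measurableSet_Ioi]
      refine integral_congr_ae (Eventually.of_forall fun y => ?_)
      by_cases hy : w ≤ y
      · have : y ∈ Set.Ioi (0 : ℝ) := by simp; linarith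
        simp [Set.indicator, hy, this]
      · simp [Set.indicator, hy]
    rw [h1]
    refine integral_mono_of_nonneg ?_ hint ?_
    · filter_upwards [ae_restrict_mem measurableSet_Ioi] with y hy
      have : 0 < y := by linarith [Set.mem_Ioi.1 hy]
      exact mul_nonneg this.le (g _).2.1
    · filter_upwards [ae_restrict_mem measurableSet_Ioi] with y hy
      have hy' := Set.mem_Ioi.1 hy
      have hy0 : 0 < y := by linarith
      have hb := hw₁ y.toNNReal (by
        rw [← NNReal.coe_le_coe, Real.coe_toNNReal _ hy0.le]; linarith)
      rw [Real.coe_toNNReal _ hy0.le, one_mul, Real.norm_of_nonneg (g _).2.1,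
        Real.norm_of_nonneg (by positivity)] at hb
      have hlog : 0 < Real.log y := Real.log_pos (by linarith)
      calc y * (g y.toNNReal : ℝ) ≤ y * (1 / (y ^ 2 * Real.log y ^ 2)) := by gcongr
        _ = 1 / (y * Real.log y ^ 2) := by field_simp
  have hlw : 0 < Real.log w := Real.log_pos hw2
  have hV : 0 ≤ V := measureReal_nonneg
  rw [nsmul_eq_mul, smul_eq_mul]
  calc ((2 : ℕ) : ℝ) * (V * _) ≤ 2 * (V * (Real.log w)⁻¹) := by
        push_cast
        gcongr
    _ ≤ (2 * V + 1) / Real.log w := by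
        rw [div_eq_mul_inv]
        have : 0 < (Real.log w)⁻¹ := by positivity
        nlinarith

/-- A multiple of the decay: `t * g t → 0`. -/
lemma tendsto_mul_link (hg_decay : (fun t : ℝ≥0 => (g t : ℝ)) =o[atTop]
      fun t : ℝ≥0 => 1 / ((t : ℝ) ^ 2 * Real.log (t : ℝ) ^ 2)) :
    Tendsto (fun t : ℝ => t * (g t.toNNReal : ℝ)) atTop (𝓝 0) := by
  have hev := hg_decay.bound one_pos
  have hcomp := (tendsto_real_toNNReal_atTop).eventually hev
  refine squeeze_zero' (g := fun t : ℝ => t⁻¹) ?_ ?_ tendsto_inv_atTop_zero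
  · filter_upwards [eventually_ge_atTop 0] with t ht
    exact mul_nonneg ht (g _).2.1
  · filter_upwards [hcomp, eventually_ge_atTop (Real.exp 1)] with t ht ht1
    have ht0 : 0 < t := lt_of_lt_of_le (Real.exp_pos 1) ht1
    have hlog : 1 ≤ Real.log t := by
      rw [← Real.log_exp 1]; exact Real.log_le_log (Real.exp_pos 1) ht1
    rw [Real.coe_toNNReal _ ht0.le, one_mul, Real.norm_of_nonneg (g _).2.1,
        Real.norm_of_nonneg (by positivity)] at ht
    calc t * (g t.toNNReal : ℝ) ≤ t * (1 / (t ^ 2 * Real.log t ^ 2)) := by gcongr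
      _ ≤ t * (1 / (t ^ 2 * 1)) := by
          gcongr
          exact one_le_pow₀ hlog
      _ = t⁻¹ := by field_simp

end

/-! ### Discrepancy between two points -/

section
variable {g : ℝ≥0 → unitInterval}

lemma norm_le_norm_of_abs_le {z w : Plane} (h : ∀ i, |z i| ≤ |w i|) : ‖z‖ ≤ ‖w‖ := by
  rw [EuclideanSpace.norm_eq, EuclideanSpace.norm_eq]
  gcongr with i
  exact h i

/-- The loss of connection in a large box when it is shifted away from the origin along an axis. -/
lemma le_integral_box_sub_shift (hg : Antitone g) (hpos : 0 < totalConnection g) {R T₁ T : ℝ}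
    (hR : 0 < R) (hRT : R ≤ T₁) (hT : T₁ ≤ T)
    (hsmall : T * (g T.toNNReal : ℝ) ≤ R ^ 2 * (g (2 * R).toNNReal : ℝ) / (2 * T₁))
    (i : Fin 2) {a : ℝ} (ha : 0 ≤ a) (haT : a ≤ T₁) :
    R ^ 2 * (g (2 * R).toNNReal : ℝ) / (2 * T₁) * a ≤
      ∫ z in openBox 0 (fun _ => T),
        (linkProb g z - linkProb g (z + EuclideanSpace.single i a)) := by
  have hI := integrable_linkProb hpos
  set B := openBox 0 (fun _ => T)
  set e : Plane := EuclideanSpace.single i a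
  have hei : e i = a := by simp [e]
  have hej : ∀ j, j ≠ i → e j = 0 := fun j hj => by simp [e, hj]
  set B' : Set Plane := {z | z - e ∈ B}
  have hBm : MeasurableSet B := measurableSet_openBox _ _
  have hBm' : MeasurableSet B' := hBm.preimage (measurable_sub_const e)
  set γ : ℝ := (g (2 * R).toNNReal : ℝ)
  have hγ : 0 ≤ γ := (g _).2.1
  have hshift : ∫ z in B, linkProb g (z + e) = ∫ z in B', linkProb g z := by
    have h := (measurePreserving_add_right (volume : Measure Plane) e).setIntegral_preimage_emb
      (measurableEmbedding_addRight e) (linkProb g) B'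
    rw [← h]
    congr 2
    ext z
    simp [B']
  -- The overlap of the box and its translate cancels. A strip near the origin is gained, where g is
  -- at least `γ`, and a strip beyond `T` is lost, where g is at most g(T); `hsmall` makes the loss
  -- at most half the gain.
  rw [integral_sub hI.integrableOn (hI.comp_add_right e).integrableOn, hshift,
    ← integral_inter_add_sdiff hBm' hI.integrableOn (s := B),
    ← integral_inter_add_sdiff hBm hI.integrableOn (s := B'), Set.inter_comm B' B]
  have hge : a * R ^ 2 * γ / T₁ ≤ ∫ z in B \ B', linkProb g z := by
    set U : Set Plane := openBox 0 (fun j => if j = i then min a R else R)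
    have hvol : (volume U).toReal = min a R * R := by
      have h1 : 0 ≤ min a R := le_min ha hR.le
      rw [volume_openBox, ENNReal.toReal_mul]
      fin_cases i
      · simp [-ENNReal.ofReal_min, ENNReal.toReal_ofReal hR.le, ENNReal.toReal_ofReal h1]
      · simp [-ENNReal.ofReal_min, ENNReal.toReal_ofReal hR.le, ENNReal.toReal_ofReal h1, mul_comm]
    have hfin : volume U ≠ ∞ := by
      rw [volume_openBox]; exact ENNReal.mul_ne_top ENNReal.ofReal_ne_top ENNReal.ofReal_ne_top
    have hU : U ⊆ B \ B' := by
      intro z hz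
      constructor
      · intro j
        have := hz j
        refine ⟨this.1, this.2.trans_le ?_⟩
        dsimp only
        split_ifs
        · exact (min_le_right _ _).trans (hRT.trans hT)
        · exact hRT.trans hT
      · intro hz'
        have h1 := (hz i).2
        have h2 := (hz' i).1
        rw [PiLp.sub_apply, hei] at h2
        simp only [if_true] at h1
        have := min_le_left a R
        simp only [Pi.zero_apply] at h2
        linarith
    have h := setIntegral_mono_on (s := U) (μ := volume)
      (f := fun _ => γ) (g := linkProb g)
      (integrableOn_const hfin) hI.integrableOn (measurableSet_openBox _ _) (by
        intro z hz
        apply le_linkProb_of_le hg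
        have hb : ∀ j, |z j| ≤ R := fun j => by
          have := hz j
          rw [abs_of_pos this.1]
          refine this.2.le.trans ?_
          dsimp only
          split_ifs
          · exact min_le_right _ _
          · exact le_rfl
        have := norm_le_abs_add z
        linarith [hb 0, hb 1])
    rw [setIntegral_const, smul_eq_mul, measureReal_def, hvol] at h
    refine le_trans ?_ (h.trans (setIntegral_linkProb_mono hpos hU))
    have hT1 : 0 < T₁ := by linarith
    -- Both `a` and `R` are at most `T₁`, so the width of the near strip is bounded below linearly
    -- in `a`, also when `a` exceeds `R`.
    have hmin : a * R / T₁ ≤ min a R := by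
      rw [le_min_iff, div_le_iff₀ hT1, div_le_iff₀ hT1]
      constructor <;> nlinarith
    calc a * R ^ 2 * γ / T₁ = a * R / T₁ * (R * γ) := by ring
      _ ≤ min a R * (R * γ) := by gcongr
      _ = min a R * R * γ := by ring
  have hle : ∫ z in B' \ B, linkProb g z ≤ a * (T * (g T.toNNReal : ℝ)) := by
    have hT0 : 0 ≤ T := by linarith
    set U : Set Plane := closedBox (fun j => if j = i then T else 0)
      (fun j => if j = i then T + a else T)
    have hvol : (volume U).toReal = a * T := by
      rw [volume_closedBox, ENNReal.toReal_mul]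
      fin_cases i
      · simp [ha, hT0]
      · simp [ha, hT0, mul_comm]
    have hfin : volume U ≠ ∞ := by
      rw [volume_closedBox]; exact ENNReal.mul_ne_top ENNReal.ofReal_ne_top ENNReal.ofReal_ne_top
    have hU : B' \ B ⊆ U := by
      rintro z ⟨hz', hz⟩
      have hj : ∀ j, j ≠ i → 0 < z j ∧ z j < T := fun j hj => by
        have := hz' j
        rw [PiLp.sub_apply, hej j hj, sub_zero] at this
        exact this
      have hi := hz' i
      rw [PiLp.sub_apply, hei] at hi
      have hi1 := hi.1
      have hi2 := hi.2
      simp only [Pi.zero_apply] at hi1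
      have hzi : T ≤ z i := by
        by_contra! hcon
        apply hz
        intro j
        by_cases hji : j = i
        · subst hji
          exact ⟨by simp only [Pi.zero_apply]; linarith, hcon⟩
        · exact hj j hji
      intro j
      by_cases hji : j = i
      · subst hji
        simp only [if_true]
        exact ⟨hzi, by linarith⟩
      · simp only [hji, if_false]
        exact ⟨(hj j hji).1.le, (hj j hji).2.le⟩
    refine (setIntegral_linkProb_mono hpos hU).trans ?_
    have h := setIntegral_mono_on (s := U) (μ := volume)
      (f := linkProb g) (g := fun _ => (g T.toNNReal : ℝ)) hI.integrableOn
      (integrableOn_const hfin) (measurableSet_closedBox _ _) (by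
        intro z hz
        apply linkProb_le_of_le hg hT0
        have := (hz i).1
        simp only [if_true] at this
        exact this.trans ((le_abs_self _).trans (abs_apply_le_norm z i)))
    rw [setIntegral_const, smul_eq_mul, measureReal_def, hvol] at h
    linarith
  have hm := mul_le_mul_of_nonneg_left hsmall ha
  have e1 : a * R ^ 2 * γ / T₁ = 2 * (R ^ 2 * γ / (2 * T₁) * a) := by
    have hT1 : T₁ ≠ 0 := by linarith
    field_simp
  rw [e1] at hge
  linarith

/-- The difference between the connection probabilities to two points, integrated over a square. -/
noncomputable def discrepancy (g : ℝ≥0 → unitInterval) (L : ℝ) (x y : Plane) : ℝ :=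
  ∫ z in centredSquare L, |linkProb g (x - z) - linkProb g (y - z)|

lemma discrepancy_comm (L : ℝ) (x y : Plane) : discrepancy g L x y = discrepancy g L y x := by
  unfold discrepancy
  simp_rw [abs_sub_comm]

/-- On the box `Q` issuing from `q` in the direction away from `p`, every point is nearer to `q`, so
the integrand has a constant sign. Reflecting moves `q` to the origin and turns `q - p` into a shift
`u` with nonnegative coordinates; keeping a single coordinate of `u` only increases the shifted
probability and reduces to `le_integral_box_sub_shift`. -/
lemma le_discrepancy_of_box (hg : Antitone g) (hpos : 0 < totalConnection g) {R T₁ T L : ℝ}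
    (hR : 0 < R) (hRT : R ≤ T₁) (hT : T₁ ≤ T)
    (hsmall : T * (g T.toNNReal : ℝ) ≤ R ^ 2 * (g (2 * R).toNNReal : ℝ) / (2 * T₁))
    (s : Fin 2 → Bool) {p q : Plane}
    (hpq : ∀ i, 0 ≤ (if s i then -1 else 1) * (q i - p i)) (hpq' : ∀ i, |q i - p i| ≤ T₁)
    (hQ : {y : Plane | ∀ i, 0 < (if s i then -1 else 1) * (y i - q i) ∧
      (if s i then -1 else 1) * (y i - q i) < T} ⊆ centredSquare L) (i : Fin 2) :
    R ^ 2 * (g (2 * R).toNNReal : ℝ) / (2 * T₁) * |q i - p i| ≤ discrepancy g L p q := by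
  have hIp := integrable_linkProb_sub hpos p
  have hIq := integrable_linkProb_sub hpos q
  have hI := integrable_linkProb hpos
  set Q := {y : Plane | ∀ i, 0 < (if s i then -1 else 1) * (y i - q i) ∧
      (if s i then -1 else 1) * (y i - q i) < T} with hQdef
  let φ : Plane → Plane := fun z => reflection s z + q
  have hφmp : MeasurePreserving φ := (measurePreserving_add_right volume q).comp
    (reflection s).measurePreserving
  have hφe : MeasurableEmbedding φ := (measurableEmbedding_addRight q).comp
    (reflection s).toMeasurableEquiv.measurableEmbedding
  have hφQ : φ ⁻¹' Q = openBox 0 (fun _ => T) := by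
    ext z
    simp only [Set.mem_preimage, hQdef, openBox]
    refine forall_congr' fun i => ?_
    simp only [φ, PiLp.add_apply, reflection_apply, add_sub_cancel_right]
    rw [← mul_assoc]
    split_ifs <;> simp
  set u : Plane := reflection s (q - p)
  have hu : ∀ i, u i = |q i - p i| := by
    intro i
    have := hpq i
    rw [show u i = (if s i then -1 else 1) * (q i - p i) by rw [reflection_apply]; rfl]
    split_ifs with h
    · simp only [h, if_true] at this
      rw [abs_of_nonpos (by linarith)]; ring
    · simp only [h, if_false, Bool.false_eq_true] at this
      rw [abs_of_nonneg (by linarith)]; ring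
  have hrr : ∀ z, reflection s (reflection s z) = z := by
    intro z
    ext i
    rw [reflection_apply, reflection_apply]
    split_ifs <;> ring
  have h1 : ∫ y in Q, (linkProb g (q - y) - linkProb g (p - y)) =
      ∫ z in openBox 0 (fun _ => T), (linkProb g z - linkProb g (z + u)) := by
    rw [← hφQ, ← hφmp.setIntegral_preimage_emb hφe]
    refine integral_congr_ae (Eventually.of_forall fun z => ?_)
    have e1 : linkProb g (q - φ z) = linkProb g z := by
      rw [linkProb_sub_comm, ← linkProb_reflection s z]; simp [φ]
    have e2 : linkProb g (p - φ z) = linkProb g (z + u) := by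
      rw [linkProb_sub_comm, ← linkProb_reflection s (z + u), map_add]
      simp only [u, hrr, φ]
      congr 1; abel
    simp only [e1, e2]
  calc _ ≤ ∫ z in openBox 0 (fun _ => T),
        (linkProb g z - linkProb g (z + EuclideanSpace.single i |q i - p i|)) :=
        le_integral_box_sub_shift hg hpos hR hRT hT hsmall i (abs_nonneg _) (hpq' i)
    _ ≤ ∫ z in openBox 0 (fun _ => T), (linkProb g z - linkProb g (z + u)) := by
        refine setIntegral_mono_on
          (hI.sub (hI.comp_add_right _)).integrableOn
          (hI.sub (hI.comp_add_right _)).integrableOn (measurableSet_openBox _ _) fun z hz => ?_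
        have : linkProb g (z + u) ≤
            linkProb g (z + EuclideanSpace.single i |q i - p i|) := by
          apply linkProb_anti hg
          apply norm_le_norm_of_abs_le
          intro j
          have hzj := (hz j).1
          simp only [Pi.zero_apply] at hzj
          have huj : 0 ≤ u j := by rw [hu]; positivity
          simp only [PiLp.add_apply]
          rw [abs_of_nonneg (a := z j + u j) (by linarith)]
          by_cases hji : j = i
          · subst hji
            rw [PiLp.single_apply, if_pos rfl, hu,
              abs_of_nonneg (add_nonneg hzj.le (abs_nonneg _))]
          · rw [PiLp.single_apply, if_neg hji, add_zero, abs_of_pos hzj]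
            linarith
        linarith
    _ = ∫ y in Q, (linkProb g (q - y) - linkProb g (p - y)) := h1.symm
    _ ≤ ∫ y in Q, |linkProb g (p - y) - linkProb g (q - y)| := by
        refine integral_mono (hIq.sub hIp).integrableOn (hIp.sub hIq).abs.integrableOn fun y => ?_
        simp only
        rw [abs_sub_comm]
        exact le_abs_self _
    _ ≤ discrepancy g L p q :=
        setIntegral_mono_set (hIp.sub hIq).abs.integrableOn
          (Eventually.of_forall fun z => abs_nonneg _) hQ.eventuallyLE

/-- Inside a square, every point lies in a small square contained in the large one. -/
lemma exists_subsquare {L m : ℝ} (hm : 0 ≤ m) (hmL : m ≤ L) {x : Plane}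
    (hx : x ∈ centredSquare L) :
    ∃ l : Fin 2 → ℝ, x ∈ closedBox l (fun i => l i + m) ∧
      closedBox l (fun i => l i + m) ⊆ centredSquare L := by
  refine ⟨fun i => max (-(L / 2)) (x i - m), fun i => ?_, fun z hz i => ?_⟩
  · have := hx i
    exact ⟨max_le this.1 (by linarith), by linarith [le_max_right (-(L / 2)) (x i - m)]⟩
  · obtain ⟨h1, h2⟩ := hx i
    obtain ⟨h3, h4⟩ := hz i
    have h5 : max (-(L / 2)) (x i - m) ≤ L / 2 - m := max_le (by linarith) (by linarith)
    dsimp only at h4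
    exact ⟨(le_max_left _ _).trans h3, by linarith⟩
end

section
variable {g : ℝ≥0 → unitInterval}

lemma volume_closedBox_add (l : Fin 2 → ℝ) {m : ℝ} (hm : 0 ≤ m) :
    (volume (closedBox l fun i => l i + m)).toReal = m ^ 2 ∧
      volume (closedBox l fun i => l i + m) ≠ ∞ := by
  rw [volume_closedBox]
  constructor
  · rw [ENNReal.toReal_mul]; simp [hm, sq]
  · exact ENNReal.mul_ne_top ENNReal.ofReal_ne_top ENNReal.ofReal_ne_top

lemma norm_sub_le_of_mem_closedBox {l : Fin 2 → ℝ} {m : ℝ} {x z : Plane}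
    (hx : x ∈ closedBox l fun i => l i + m) (hz : z ∈ closedBox l fun i => l i + m) :
    ‖x - z‖ ≤ 2 * m := by
  have h : ∀ i, |(x - z) i| ≤ m := fun i => by
    have h1 := hx i
    have h2 := hz i
    rw [PiLp.sub_apply, abs_le]
    constructor <;> linarith [h1.1, h1.2, h2.1, h2.2]
  linarith [norm_le_abs_add (x - z), h 0, h 1]

lemma sq_mul_le_coverage (hg : Antitone g) (hpos : 0 < totalConnection g) {L R m : ℝ} (hm : 0 ≤ m)
    (hmR : m ≤ R) (hmL : m ≤ L) {x : Plane} (hx : x ∈ centredSquare L) :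
    m ^ 2 * (g (2 * R).toNNReal : ℝ) ≤ coverage g L x := by
  obtain ⟨l, hxl, hl⟩ := exists_subsquare hm hmL hx
  obtain ⟨hvol, hfin⟩ := volume_closedBox_add l hm
  have hI := integrable_linkProb_sub hpos x
  have h := setIntegral_mono_on (s := closedBox l fun i => l i + m) (μ := volume)
    (f := fun _ => (g (2 * R).toNNReal : ℝ)) (g := fun y => linkProb g (x - y))
    (integrableOn_const hfin) hI.integrableOn (measurableSet_closedBox _ _) (by
      intro z hz
      apply le_linkProb_of_le hg
      linarith [norm_sub_le_of_mem_closedBox hxl hz])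
  rw [setIntegral_const, smul_eq_mul, measureReal_def, hvol] at h
  exact h.trans (setIntegral_mono_set hI.integrableOn
    (Eventually.of_forall fun z => linkProb_nonneg _) hl.eventuallyLE)

/-- Away from the corners of a large square, the neighbourhoods of two distinct points differ by an
amount that is at least linear in their distance. -/
lemma exists_le_discrepancy (hg : Antitone g)
    (hg_decay : (fun t : ℝ≥0 => (g t : ℝ)) =o[atTop]
      fun t : ℝ≥0 => 1 / ((t : ℝ) ^ 2 * Real.log (t : ℝ) ^ 2))
    (hpos : 0 < totalConnection g) :
    ∃ c T : ℝ, 0 < c ∧ 0 < T ∧ ∀ L, T ≤ L → ∀ x ∈ centredSquare L, ∀ y ∈ centredSquare L,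
      (∃ i, |x i| ≤ L / 2 - T) → c * min ‖x - y‖ 1 ≤ discrepancy g L x y := by
  obtain ⟨R, hR, hγ⟩ := exists_pos_link hg hpos
  set γ : ℝ := (g (2 * R).toNNReal : ℝ) with hγdef
  have hlim := tendsto_mul_link hg_decay
  -- As `t₁ ≥ 1`, the bound on t₁ g(t₁) also gives g(t₁) ≤ γ / 2. Points farther apart than t₁ + 2R
  -- are then told apart by the part of the square near `x`.
  obtain ⟨t₁, ht₁, ht₁'⟩ := ((hlim.eventually_le_const (half_pos hγ)).and
    (eventually_ge_atTop 1)).exists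
  have hgt₁ : (g t₁.toNNReal : ℝ) ≤ γ / 2 := by
    refine le_trans ?_ ht₁
    nlinarith [(g t₁.toNNReal).2.1]
  set T₁ := t₁ + 2 * R with hT₁
  have hT₁pos : 0 < T₁ := by positivity
  have hcpos : 0 < R ^ 2 * γ / (2 * T₁) := by positivity
  obtain ⟨T', hT', hT'₁⟩ := ((hlim.eventually_le_const hcpos).and
    (eventually_ge_atTop T₁)).exists
  refine ⟨min (R ^ 2 * γ / (2 * T₁) / 2) (R ^ 2 * γ / 2), 2 * (T₁ + T'), by positivity,
    by linarith, ?_⟩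
  intro L hL x hx y hy hxi
  have hIx := integrable_linkProb_sub hpos x
  have hIy := integrable_linkProb_sub hpos y
  have hmin0 : 0 ≤ min ‖x - y‖ 1 := le_min (norm_nonneg _) zero_le_one
  by_cases hfar : T₁ ≤ ‖x - y‖
  · obtain ⟨l, hxl, hl⟩ := exists_subsquare hR.le (by linarith : R ≤ L) hx
    obtain ⟨hvol, hfin⟩ := volume_closedBox_add l hR.le
    have h := setIntegral_mono_on (s := closedBox l fun i => l i + R) (μ := volume)
      (f := fun _ => γ / 2) (g := fun z => |linkProb g (x - z) - linkProb g (y - z)|)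
      (integrableOn_const hfin) (hIx.sub hIy).abs.integrableOn (measurableSet_closedBox _ _) (by
        intro z hz
        have hxz := norm_sub_le_of_mem_closedBox hxl hz
        have h1 : γ ≤ linkProb g (x - z) := le_linkProb_of_le hg hxz
        have h2 : linkProb g (y - z) ≤ g t₁.toNNReal := by
          apply linkProb_le_of_le hg (by linarith)
          have h3 : x - y = (x - z) - (y - z) := by abel
          have h4 := norm_sub_le (x - z) (y - z)
          rw [← h3] at h4
          linarith
        refine le_trans ?_ (le_abs_self _)
        linarith)
    rw [setIntegral_const, smul_eq_mul, measureReal_def, hvol] at h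
    have h' : R ^ 2 * (γ / 2) ≤ discrepancy g L x y :=
      h.trans (setIntegral_mono_set (hIx.sub hIy).abs.integrableOn
        (Eventually.of_forall fun z => abs_nonneg _) hl.eventuallyLE)
    calc _ ≤ R ^ 2 * γ / 2 * 1 :=
          mul_le_mul (min_le_right _ _) (min_le_right _ _) hmin0 (by positivity)
      _ = R ^ 2 * (γ / 2) := by ring
      _ ≤ _ := h'
  · push Not at hfar
    have hd : ∀ i, |x i - y i| ≤ T₁ := fun i => by
      have := abs_apply_le_norm (x - y) i
      rw [PiLp.sub_apply] at this
      linarith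
    obtain ⟨i₀, hi₀⟩ := hxi
    -- the sign prescribing the direction with enough room in each coordinate
    have hroom : ∀ (p q : Plane), (∀ i, |q i - p i| ≤ T₁) → (p = x ∨ q = x) →
        p ∈ centredSquare L → q ∈ centredSquare L →
        (∀ i, i ≠ i₀ → 0 ≤ (if x i ≤ 0 then 1 else -1) * (q i - p i)) →
        ∃ s : Fin 2 → Bool, (∀ i, 0 ≤ (if s i then -1 else 1) * (q i - p i)) ∧
        {y : Plane | ∀ i, 0 < (if s i then -1 else 1) * (y i - q i) ∧
          (if s i then -1 else 1) * (y i - q i) < T'} ⊆ centredSquare L := by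
      intro p q hpq hx' hp hq hdir
      have hqx : ∀ i, |q i - x i| ≤ T₁ := fun i => by
        rcases hx' with h | h
        · rw [← h]; exact hpq i
        · rw [h]; simp; exact hT₁pos.le
      -- In coordinate `i₀` there is room on both sides, so the box may point away from `p`; in the
      -- other coordinate it points towards the centre line of the square.
      refine ⟨fun i => if i = i₀ then decide (q i - p i < 0) else decide (0 < x i), ?_, ?_⟩
      · intro i
        by_cases hi : i = i₀
        · simp only [hi, if_true]
          by_cases h : q i₀ - p i₀ < 0
          · simp only [h, decide_true, if_true]; linarith
          · simp only [h, decide_false, Bool.false_eq_true, if_false]; linarith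
        · have := hdir i hi
          simp only [hi, if_false]
          by_cases h : 0 < x i
          · simpa only [h, not_le.2 h, decide_true, if_true, if_false] using this
          · simpa only [h, not_lt.1 h, decide_false, if_true, if_false, Bool.false_eq_true]
              using this
      · intro z hz i
        have h1 := hz i
        have h2 := abs_le.1 (hqx i)
        have h3 := hq i
        by_cases hi : i = i₀
        · subst hi
          have h4 := abs_le.1 hi₀
          simp only [if_true] at h1
          by_cases h : q i - p i < 0
          · simp only [h, decide_true, if_true] at h1
            constructor <;> linarith [h3.1, h3.2]
          · simp only [h, decide_false, Bool.false_eq_true, if_false] at h1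
            constructor <;> linarith [h3.1, h3.2]
        · simp only [hi, if_false] at h1
          by_cases h : 0 < x i
          · simp only [h, decide_true, if_true] at h1
            constructor <;> linarith [h3.1, h3.2]
          · simp only [h, decide_false, Bool.false_eq_true, if_false] at h1
            constructor <;> linarith [h3.1, h3.2]
    have hall : ∀ i, R ^ 2 * γ / (2 * T₁) * |x i - y i| ≤ discrepancy g L x y := by
      -- The box is issued from whichever of `x`, `y` lies further in the inward direction in the
      -- coordinate other than `i₀`, so that pointing inwards also means pointing away from the
      -- other point.
      by_cases hdir : ∀ i, i ≠ i₀ → 0 ≤ (if x i ≤ 0 then 1 else -1) * (y i - x i)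
      · have hd' : ∀ i, |y i - x i| ≤ T₁ := fun i => by rw [abs_sub_comm]; exact hd i
        obtain ⟨s, hs, hsub⟩ := hroom x y hd' (Or.inl rfl) hx hy hdir
        intro i
        rw [abs_sub_comm]
        exact le_discrepancy_of_box hg hpos hR (by linarith) hT'₁ hT' s hs hd' hsub i
      · have hdir' : ∀ i, i ≠ i₀ → 0 ≤ (if x i ≤ 0 then 1 else -1) * (x i - y i) := by
          push Not at hdir
          obtain ⟨j, hj, hneg⟩ := hdir
          intro i hi
          have : i = j := by omega
          subst this
          linarith
        obtain ⟨s, hs, hsub⟩ := hroom y x hd (Or.inr rfl) hy hx hdir'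
        intro i
        rw [discrepancy_comm]
        exact le_discrepancy_of_box hg hpos hR (by linarith) hT'₁ hT' s hs hd hsub i
    have hn := norm_le_abs_add (x - y)
    rw [PiLp.sub_apply, PiLp.sub_apply] at hn
    calc _ ≤ R ^ 2 * γ / (2 * T₁) / 2 * ‖x - y‖ :=
          mul_le_mul (min_le_left _ _) (min_le_left _ _) hmin0 (by positivity)
      _ ≤ R ^ 2 * γ / (2 * T₁) / 2 * (|x 0 - y 0| + |x 1 - y 1|) := by gcongr
      _ ≤ _ := by linarith [hall 0, hall 1]

end

/-! ### Coverage of a cluster -/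

section
variable {g : ℝ≥0 → unitInterval}

lemma volume_centredSquare {L : ℝ} (hL : 0 ≤ L) :
    volume (centredSquare L) = ENNReal.ofReal (L ^ 2) := by
  rw [centredSquare_eq, volume_closedBox, ← ENNReal.ofReal_mul (by linarith)]
  congr 1; ring

lemma volume_centredSquare_ne_top (L : ℝ) : volume (centredSquare L) ≠ ∞ := by
  rw [centredSquare_eq, volume_closedBox]
  exact ENNReal.mul_ne_top ENNReal.ofReal_ne_top ENNReal.ofReal_ne_top

/-- The area-weighted probability that a point of the square is joined to one of the `x i`. -/
noncomputable def clusterCoverage (g : ℝ≥0 → unitInterval) (L : ℝ) {k : ℕ}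
    (x : Fin (k + 1) → Plane) : ℝ :=
  ∫ y in centredSquare L, (1 - ∏ i, (1 - linkProb g (x i - y)))

lemma prod_one_sub_mem {k : ℕ} (x : Fin (k + 1) → Plane) (y : Plane) :
    0 ≤ ∏ i, (1 - linkProb g (x i - y)) ∧ ∏ i, (1 - linkProb g (x i - y)) ≤ 1 := by
  have h0 : ∀ i, 0 ≤ 1 - linkProb g (x i - y) := fun i => sub_nonneg.2 (linkProb_le_one _)
  exact ⟨Finset.prod_nonneg fun i _ => h0 i, Finset.prod_le_one (fun i _ => h0 i)
    fun _ _ => sub_le_self _ (linkProb_nonneg _)⟩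

lemma measurable_prod_one_sub (hg : Antitone g) {k : ℕ} (x : Fin (k + 1) → Plane) :
    Measurable fun y => ∏ i, (1 - linkProb g (x i - y)) :=
  Finset.measurable_prod _ fun _ _ => measurable_const.sub
    ((measurable_linkProb hg).comp (measurable_const.sub measurable_id))

lemma integrableOn_prod_one_sub (hg : Antitone g) (L : ℝ) {k : ℕ} (x : Fin (k + 1) → Plane) :
    IntegrableOn (fun y => ∏ i, (1 - linkProb g (x i - y))) (centredSquare L) := by
  refine IntegrableOn.of_bound (volume_centredSquare_ne_top L).lt_top
    (measurable_prod_one_sub hg x).aestronglyMeasurable 1 (Eventually.of_forall fun y => ?_)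
  obtain ⟨h0, h1⟩ := prod_one_sub_mem (g := g) x y
  rw [Real.norm_of_nonneg h0]; exact h1

lemma integrableOn_one_sub_prod (hg : Antitone g) (L : ℝ) {k : ℕ} (x : Fin (k + 1) → Plane) :
    IntegrableOn (fun y => 1 - ∏ i, (1 - linkProb g (x i - y))) (centredSquare L) :=
  (integrableOn_const (volume_centredSquare_ne_top L)).sub (integrableOn_prod_one_sub hg L x)

lemma lintegral_cond_centredSquare {L : ℝ} (hL : 0 < L) (h : Plane → ℝ≥0∞) :
    ∫⁻ y, h y ∂(ProbabilityTheory.cond volume (centredSquare L)) =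
      ENNReal.ofReal (1 / L ^ 2) * ∫⁻ y in centredSquare L, h y := by
  rw [ProbabilityTheory.cond, lintegral_smul_measure, volume_centredSquare hL.le, smul_eq_mul,
    ← ENNReal.ofReal_inv_of_pos (by positivity), one_div]

/-- This turns the Poisson exponent, mean number of nodes times probability of being joined to the
cluster, into density times `clusterCoverage`. -/
lemma one_sub_avoidance (hg : Antitone g) {L : ℝ} (hL : 0 < L) {k : ℕ} (x : Fin (k + 1) → Plane) :
    L ^ 2 * (1 - (avoidance g (ProbabilityTheory.cond volume (centredSquare L)) x).toReal) =
      clusterCoverage g L x := by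
  have h1 : (avoidance g (ProbabilityTheory.cond volume (centredSquare L)) x).toReal =
      1 / L ^ 2 * ∫ y in centredSquare L, ∏ i, (1 - linkProb g (x i - y)) := by
    rw [avoidance, lintegral_cond_centredSquare hL, ENNReal.toReal_mul,
      ENNReal.toReal_ofReal (by positivity), integral_eq_lintegral_of_nonneg_ae
      (Eventually.of_forall fun y => (prod_one_sub_mem x y).1)
      (measurable_prod_one_sub hg x).aestronglyMeasurable]
    congr 3
    funext y
    rw [ENNReal.ofReal_prod_of_nonneg]
    · simp only [linkProb, nndist_eq_nnnorm]
    · intro i _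
      linarith [linkProb_le_one (g := g) (x i - y)]
  have hc : Integrable (fun _ => (1 : ℝ)) (volume.restrict (centredSquare L)) :=
    integrableOn_const (volume_centredSquare_ne_top L)
  rw [h1, clusterCoverage, integral_sub hc
    (integrableOn_prod_one_sub hg L x), setIntegral_const, measureReal_def,
    volume_centredSquare hL.le, ENNReal.toReal_ofReal (by positivity)]
  simp only [smul_eq_mul]
  field_simp

/-- The probability of being joined to the cluster is at least that of being joined to either of two
members, hence at least max(a, b) = (a + b)/2 + |a - b|/2. -/
lemma half_add_half_discrepancy_le (hg : Antitone g) (hpos : 0 < totalConnection g) (L : ℝ) {k : ℕ}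
    (x : Fin (k + 1) → Plane) (i j : Fin (k + 1)) :
    (coverage g L (x i) + coverage g L (x j)) / 2 + discrepancy g L (x i) (x j) / 2 ≤
      clusterCoverage g L x := by
  have hi := (integrable_linkProb_sub hpos (x i)).integrableOn (s := centredSquare L)
  have hj := (integrable_linkProb_sub hpos (x j)).integrableOn (s := centredSquare L)
  have hA : Integrable (fun y => (linkProb g (x i - y) + linkProb g (x j - y)) / 2)
      (volume.restrict (centredSquare L)) := (hi.add hj).div_const 2
  have hD : Integrable (fun y => |linkProb g (x i - y) - linkProb g (x j - y)| / 2)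
      (volume.restrict (centredSquare L)) := (hi.sub hj).abs.div_const 2
  have hsum : (coverage g L (x i) + coverage g L (x j)) / 2 + discrepancy g L (x i) (x j) / 2 =
      ∫ y in centredSquare L, ((linkProb g (x i - y) + linkProb g (x j - y)) / 2 +
        |linkProb g (x i - y) - linkProb g (x j - y)| / 2) := by
    rw [integral_add hA hD, integral_div,
      integral_div, integral_add hi hj]
    rfl
  rw [hsum]
  refine integral_mono (hA.add hD)
    (integrableOn_one_sub_prod hg L x) fun y => ?_
  have hle : ∀ l, ∏ i, (1 - linkProb g (x i - y)) ≤ 1 - linkProb g (x l - y) := by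
    intro l
    rw [← Finset.mul_prod_erase _ _ (Finset.mem_univ l)]
    refine mul_le_of_le_one_right (by linarith [linkProb_le_one (g := g) (x l - y)]) ?_
    refine Finset.prod_le_one (fun i _ => ?_) (fun i _ => ?_)
    · linarith [linkProb_le_one (g := g) (x i - y)]
    · linarith [linkProb_nonneg (g := g) (x i - y)]
  have h1 := hle i
  have h2 := hle j
  simp only
  rcases abs_cases (linkProb g (x i - y) - linkProb g (x j - y)) with ⟨h, -⟩ | ⟨h, -⟩ <;>
    rw [h] <;> linarith

lemma coverage_le_clusterCoverage (hg : Antitone g) (hpos : 0 < totalConnection g) (L : ℝ) {k : ℕ}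
    (x : Fin (k + 1) → Plane) (i : Fin (k + 1)) :
    coverage g L (x i) ≤ clusterCoverage g L x := by
  have h := half_add_half_discrepancy_le hg hpos L x i i
  have : discrepancy g L (x i) (x i) = 0 := by simp [discrepancy]
  linarith

/-- The extra coverage of a spread-out cluster, in terms of the edge lengths of a tree on it. -/
lemma coverage_add_sum_le (hg : Antitone g) (hpos : 0 < totalConnection g) {L c : ℝ} (hc : 0 ≤ c)
    {k : ℕ} (hk : 0 < k) (p : Fin k → Fin (k + 1)) (x : Fin (k + 1) → Plane)
    (hroot : ∀ j, coverage g L (x 0) ≤ coverage g L (x j))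
    (hdisc : ∀ j, c * min ‖x 0 - x j‖ 1 ≤ discrepancy g L (x 0) (x j)) :
    coverage g L (x 0) + c / (4 * k) * ∑ j : Fin k, min ‖x j.succ - x (p j)‖ 1 ≤
      clusterCoverage g L x := by
  have hV : ∀ j, c * min ‖x 0 - x j‖ 1 ≤ 2 * (clusterCoverage g L x - coverage g L (x 0)) := by
    intro j
    have := half_add_half_discrepancy_le hg hpos L x 0 j
    linarith [hroot j, hdisc j]
  have hedge : ∀ j : Fin k, c * min ‖x j.succ - x (p j)‖ 1 ≤
      4 * (clusterCoverage g L x - coverage g L (x 0)) := by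
    intro j
    -- Truncation at 1 preserves the triangle inequality, so an edge is bounded by the two truncated
    -- distances of its ends to the root. Averaging over the `k` edges then gives the constant c /
    -- (4k).
    have htri : min ‖x j.succ - x (p j)‖ 1 ≤ min ‖x 0 - x j.succ‖ 1 + min ‖x 0 - x (p j)‖ 1 := by
      have h1 : ‖x j.succ - x (p j)‖ ≤ ‖x 0 - x j.succ‖ + ‖x 0 - x (p j)‖ := by
        have := norm_sub_le (x 0 - x (p j)) (x 0 - x j.succ)
        rw [sub_sub_sub_cancel_left] at this
        linarith
      rcases le_total ‖x 0 - x j.succ‖ 1 with h2 | h2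
      · rcases le_total ‖x 0 - x (p j)‖ 1 with h3 | h3
        · rw [min_eq_left h2, min_eq_left h3]
          exact (min_le_left _ _).trans h1
        · rw [min_eq_right h3]
          exact (min_le_right _ _).trans (by
            linarith [le_min (norm_nonneg (x 0 - x j.succ)) zero_le_one])
      · rw [min_eq_right h2]
        exact (min_le_right _ _).trans (by
          linarith [le_min (norm_nonneg (x 0 - x (p j))) zero_le_one])
    have := mul_le_mul_of_nonneg_left htri hc
    linarith [hV j.succ, hV (p j)]
  have hsum := Finset.sum_le_sum fun j (_ : j ∈ Finset.univ) => hedge j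
  rw [← Finset.mul_sum, Finset.sum_const, Finset.card_univ, Fintype.card_fin, nsmul_eq_mul] at hsum
  have hk' : (0 : ℝ) < k := by exact_mod_cast hk
  have : c / (4 * k) * ∑ j : Fin k, min ‖x j.succ - x (p j)‖ 1 =
      (c * ∑ j : Fin k, min ‖x j.succ - x (p j)‖ 1) / (4 * k) := by ring
  rw [this, ← le_sub_iff_add_le', div_le_iff₀ (by positivity)]
  linarith

lemma measurable_coverage (hg : Antitone g) (L : ℝ) : Measurable (coverage g L) := by
  have h : Measurable (Function.uncurry fun x y : Plane => linkProb g (x - y)) :=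
    (measurable_linkProb hg).comp (measurable_fst.sub measurable_snd)
  exact (h.stronglyMeasurable.integral_prod_right
    (ν := volume.restrict (centredSquare L))).measurable

end

/-! ### Bounds for the cluster integral -/

lemma volume_setOf_apply_mem {S U : Set ℝ} (hS : MeasurableSet S) (hU : MeasurableSet U) :
    volume {x : Plane | x 0 ∈ S ∧ x 1 ∈ U} = volume S * volume U := by
  have h : {x : Plane | x 0 ∈ S ∧ x 1 ∈ U} = (WithLp.ofLp : Plane → Fin 2 → ℝ) ⁻¹'
      (Set.univ.pi ![S, U]) := by
    ext x
    simp only [Set.mem_preimage, Set.mem_univ_pi, Fin.forall_fin_two]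
    rfl
  have hm : MeasurableSet (Set.univ.pi ![S, U]) := by
    refine MeasurableSet.univ_pi fun i => ?_
    fin_cases i
    · exact hS
    · exact hU
  rw [h, (PiLp.volume_preserving_ofLp (Fin 2)).measure_preimage hm.nullMeasurableSet, volume_pi,
    Measure.pi_pi]
  simp

/-- The points of `[-L / 2, L / 2]` at distance at most `t` from the end points. -/
def edgeStrip (L t : ℝ) : Set ℝ := {u | |u| ≤ L / 2 ∧ L / 2 - t ≤ |u|}

lemma measurableSet_edgeStrip (L t : ℝ) : MeasurableSet (edgeStrip L t) :=
  (measurableSet_le measurable_id.abs measurable_const).inter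
    (measurableSet_le measurable_const measurable_id.abs)

lemma volume_edgeStrip_le (L : ℝ) {t : ℝ} (ht : 0 ≤ t) :
    volume (edgeStrip L t) ≤ ENNReal.ofReal (2 * t) := by
  have hsub : edgeStrip L t ⊆ Set.Icc (L / 2 - t) (L / 2) ∪ Set.Icc (-(L / 2)) (t - L / 2) := by
    rintro u ⟨h1, h2⟩
    rcases abs_cases u with ⟨h, -⟩ | ⟨h, -⟩
    · left; constructor <;> linarith
    · right; constructor <;> linarith
  refine (measure_mono hsub).trans ((measure_union_le _ _).trans ?_)
  rw [Real.volume_Icc, Real.volume_Icc, ← ENNReal.ofReal_add (by linarith) (by linarith)]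
  apply ENNReal.ofReal_le_ofReal
  linarith

section
variable {g : ℝ≥0 → unitInterval}

/-- The first-moment integral of the clusters of `k + 1` nodes spanned by the tree `p`, for node
density `d` on the square of side `L`. -/
noncomputable def clusterIntegral (g : ℝ≥0 → unitInterval) (d L : ℝ) {k : ℕ}
    (p : Fin k → Fin (k + 1)) : ℝ≥0∞ :=
  ∫⁻ x, treeWeight g (coverage g L) p x *
    ENNReal.ofReal ((d * L ^ 2) ^ (k + 1) * Real.exp (-(d * clusterCoverage g L x)))
    ∂(Measure.pi fun _ => ProbabilityTheory.cond (volume : Measure Plane) (centredSquare L))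

lemma isProbabilityMeasure_cond_centredSquare {L : ℝ} (hL : 0 < L) :
    IsProbabilityMeasure (ProbabilityTheory.cond (volume : Measure Plane) (centredSquare L)) := by
  refine ProbabilityTheory.cond_isProbabilityMeasure_of_finite ?_ (volume_centredSquare_ne_top L)
  rw [volume_centredSquare hL.le]
  exact (ENNReal.ofReal_pos.2 (by positivity)).ne'

lemma networkLaw_exists_component_le_sum (hg : Antitone g) (d : ℝ≥0) {L : ℝ} (hL : 0 < L) (M : ℕ) :
    networkLaw d (centredSquare L) {ω | ∃ c : (connectionGraph g ω).ConnectedComponent,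
      1 < c.supp.ncard ∧ c.supp.ncard ≤ M} ≤
    ∑ k ∈ Finset.Ico 1 M, ∑ p : {p : Fin k → Fin (k + 1) // ∀ j, p j ≤ j.castSucc},
      clusterIntegral g d L p.1 := by
  have h0 : volume (centredSquare L) ≠ 0 := by
    rw [volume_centredSquare hL.le]
    exact (ENNReal.ofReal_pos.2 (by positivity)).ne'
  refine (networkLaw_exists_component_le hg.measurable (measurable_coverage hg L) d h0
    (volume_centredSquare_ne_top L) M).trans (le_of_eq ?_)
  refine Finset.sum_congr rfl fun k _ => Finset.sum_congr rfl fun p _ =>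
    lintegral_congr fun x => ?_
  have hv : ((d * (volume (centredSquare L)).toNNReal : ℝ≥0) : ℝ) = d * L ^ 2 := by
    rw [NNReal.coe_mul, volume_centredSquare hL.le, ENNReal.ofReal, ENNReal.toNNReal_coe,
      Real.coe_toNNReal _ (by positivity)]
  rw [hv, mul_assoc (d : ℝ) (L ^ 2) (1 - _), one_sub_avoidance hg hL]

lemma ae_forall_mem_centredSquare {L : ℝ} (hL : 0 < L) (n : ℕ) :
    ∀ᵐ x ∂(Measure.pi fun _ : Fin n =>
      ProbabilityTheory.cond (volume : Measure Plane) (centredSquare L)),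
      ∀ i, x i ∈ centredSquare L := by
  have := isProbabilityMeasure_cond_centredSquare hL
  rw [ae_all_iff]
  intro i
  exact (measurePreserving_eval (fun _ : Fin n =>
    ProbabilityTheory.cond (volume : Measure Plane) (centredSquare L)) i).quasiMeasurePreserving.ae
    (ProbabilityTheory.ae_cond_mem (measurableSet_centredSquare L))

lemma treeWeight_le {S : Plane → ℝ} {k : ℕ} (p : Fin k → Fin (k + 1)) (x : Fin (k + 1) → Plane) :
    treeWeight g S p x ≤ ∏ j : Fin k, ENNReal.ofReal (linkProb g (x j.succ - x (p j))) := by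
  refine (Set.indicator_le_self _ _ x).trans (le_of_eq ?_)
  simp only [linkProb, nndist_eq_nnnorm]

lemma treeWeight_le_one {S : Plane → ℝ} {k : ℕ} (p : Fin k → Fin (k + 1))
    (x : Fin (k + 1) → Plane) : treeWeight g S p x ≤ 1 :=
  (treeWeight_le p x).trans (Finset.prod_le_one' fun _ _ =>
    ENNReal.ofReal_le_one.2 (linkProb_le_one _))

/-- The bound on the first-moment integral used for small squares. -/
lemma clusterIntegral_le_of_coverage (hg : Antitone g) (hpos : 0 < totalConnection g) {d L c : ℝ}
    (hd : 0 ≤ d) (hL : 0 < L) (hc : ∀ x ∈ centredSquare L, c ≤ coverage g L x) {k : ℕ}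
    (p : Fin k → Fin (k + 1)) :
    clusterIntegral g d L p ≤ ENNReal.ofReal ((d * L ^ 2) ^ (k + 1) * Real.exp (-(d * c))) := by
  have := isProbabilityMeasure_cond_centredSquare hL
  calc clusterIntegral g d L p ≤ ∫⁻ _, ENNReal.ofReal ((d * L ^ 2) ^ (k + 1) * Real.exp (-(d * c)))
        ∂(Measure.pi fun _ : Fin (k + 1) =>
          ProbabilityTheory.cond (volume : Measure Plane) (centredSquare L)) := by
        refine lintegral_mono_ae ?_
        filter_upwards [ae_forall_mem_centredSquare hL (k + 1)] with x hx
        calc _ ≤ 1 * ENNReal.ofReal ((d * L ^ 2) ^ (k + 1) * Real.exp (-(d * c))) := by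
              gcongr
              · exact treeWeight_le_one p x
              · exact (hc _ (hx 0)).trans (coverage_le_clusterCoverage hg hpos L x 0)
          _ = _ := one_mul _
    _ = _ := by simp

/-- The bound on the first-moment integral used for large squares. -/
lemma clusterIntegral_le_of_discrepancy (hg : Antitone g) (hpos : 0 < totalConnection g)
    {d L c T c₀ J κ : ℝ} (hd : 0 ≤ d) (hL : 0 < L) (hc : 0 ≤ c) (hT : 0 ≤ T)
    (hdisc : ∀ x ∈ centredSquare L, ∀ y ∈ centredSquare L,
      (∃ i, |x i| ≤ L / 2 - T) → c * min ‖x - y‖ 1 ≤ discrepancy g L x y)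
    (hc₀ : ∀ x ∈ centredSquare L, c₀ ≤ coverage g L x) {k : ℕ} (hk : 0 < k)
    (p : Fin k → Fin (k + 1)) (hp : ∀ j, p j ≤ j.castSucc) (hJ0 : 0 ≤ J) (hκ0 : 0 ≤ κ)
    (hJ : ∫⁻ x in centredSquare L, ENNReal.ofReal (Real.exp (-(d * coverage g L x))) ≤
      ENNReal.ofReal J)
    (hκ : ∫⁻ z, ENNReal.ofReal (linkProb g z * Real.exp (-(d * (c / (4 * k)) * min ‖z‖ 1))) ≤
      ENNReal.ofReal κ) :
    clusterIntegral g d L p ≤ ENNReal.ofReal (d * (4 * T ^ 2 * Real.exp (-(d * c₀))) *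
      (d * totalConnection g) ^ k + d * J * (d * κ) ^ k) := by
  have := isProbabilityMeasure_cond_centredSquare hL
  set ν := ProbabilityTheory.cond (volume : Measure Plane) (centredSquare L) with hν
  have hC : 0 ≤ totalConnection g := hpos.le
  set corner : Set Plane := {x | x 0 ∈ edgeStrip L T ∧ x 1 ∈ edgeStrip L T} with hcorner
  have hcm : MeasurableSet corner :=
    (measurableSet_edgeStrip L T |>.preimage (measurable_plane_apply 0)).inter
      (measurableSet_edgeStrip L T |>.preimage (measurable_plane_apply 1))
  let F₁ : Plane → ℝ≥0∞ := corner.indicator fun _ => ENNReal.ofReal (Real.exp (-(d * c₀)))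
  let F₂ : Plane → ℝ≥0∞ := fun x => ENNReal.ofReal (Real.exp (-(d * coverage g L x)))
  let κ₁ : Plane → ℝ≥0∞ := fun z => ENNReal.ofReal (linkProb g z)
  let κ₂ : Plane → ℝ≥0∞ := fun z =>
    ENNReal.ofReal (linkProb g z * Real.exp (-(d * (c / (4 * k)) * min ‖z‖ 1)))
  have hF₁ : Measurable F₁ := measurable_const.indicator hcm
  have hF₂ : Measurable F₂ := by
    have := measurable_coverage hg L
    fun_prop
  have hκ₁ : Measurable κ₁ := (measurable_linkProb hg).ennreal_ofReal
  have hκ₂ : Measurable κ₂ := by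
    have := measurable_linkProb hg
    fun_prop
  -- Both majorants factor along the tree: `F₁`, `κ₁` serve roots near a corner, where no
  -- discrepancy bound is available, and `F₂`, `κ₂` all other roots.
  have hpoint : ∀ x : Fin (k + 1) → Plane, (∀ i, x i ∈ centredSquare L) →
      treeWeight g (coverage g L) p x * ENNReal.ofReal (Real.exp (-(d * clusterCoverage g L x))) ≤
      F₁ (x 0) * ∏ j : Fin k, κ₁ (x j.succ - x (p j)) +
        F₂ (x 0) * ∏ j : Fin k, κ₂ (x j.succ - x (p j)) := by
    intro x hx
    by_cases hroot : ∀ j, coverage g L (x 0) ≤ coverage g L (x j)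
    swap
    · have : treeWeight g (coverage g L) p x = 0 := Set.indicator_of_notMem (by exact hroot) _
      rw [this, zero_mul]; exact bot_le
    by_cases hx0 : x 0 ∈ corner
    · refine le_trans ?_ le_self_add
      rw [mul_comm]
      refine mul_le_mul' ?_ (treeWeight_le p x)
      simp only [F₁, Set.indicator_of_mem hx0]
      gcongr
      exact (hc₀ _ (hx 0)).trans (coverage_le_clusterCoverage hg hpos L x 0)
    · refine le_trans ?_ le_add_self
      have hi : ∃ i, |x 0 i| ≤ L / 2 - T := by
        by_contra! hcon
        apply hx0
        have habs : ∀ i, |x 0 i| ≤ L / 2 := fun i => abs_le.2 (hx 0 i)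
        exact ⟨⟨habs 0, (hcon 0).le⟩, ⟨habs 1, (hcon 1).le⟩⟩
      have hV := coverage_add_sum_le hg hpos hc hk p x hroot
        (fun j => hdisc _ (hx 0) _ (hx j) hi)
      have hexp : Real.exp (-(d * clusterCoverage g L x)) ≤ Real.exp (-(d * coverage g L (x 0))) *
          ∏ j : Fin k, Real.exp (-(d * (c / (4 * k)) * min ‖x j.succ - x (p j)‖ 1)) := by
        rw [← Real.exp_sum, ← Real.exp_add]
        apply Real.exp_le_exp.2
        rw [Finset.sum_neg_distrib, ← Finset.mul_sum]
        nlinarith [mul_le_mul_of_nonneg_left hV hd]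
      calc _ ≤ (∏ j : Fin k, ENNReal.ofReal (linkProb g (x j.succ - x (p j)))) *
            ENNReal.ofReal (Real.exp (-(d * coverage g L (x 0))) *
            ∏ j : Fin k, Real.exp (-(d * (c / (4 * k)) * min ‖x j.succ - x (p j)‖ 1))) :=
            mul_le_mul' (treeWeight_le p x) (ENNReal.ofReal_le_ofReal hexp)
        _ = _ := by
            rw [ENNReal.ofReal_mul (Real.exp_pos _).le,
              ENNReal.ofReal_prod_of_nonneg fun _ _ => (Real.exp_pos _).le, mul_left_comm,
              ← Finset.prod_mul_distrib]
            simp only [F₂, κ₂, ENNReal.ofReal_mul (linkProb_nonneg _)]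
  have htree : ∀ (F κ' : Plane → ℝ≥0∞) (hF : Measurable F) (hκ' : Measurable κ') (K : ℝ)
      (hK : ∫⁻ z, κ' z ≤ ENNReal.ofReal K),
      ∫⁻ x, F (x 0) * ∏ j : Fin k, κ' (x j.succ - x (p j)) ∂(Measure.pi fun _ => ν) ≤
      (ENNReal.ofReal (1 / L ^ 2) * ∫⁻ y in centredSquare L, F y) *
        (ENNReal.ofReal (1 / L ^ 2) * ENNReal.ofReal K) ^ k := by
    intro F κ' hF hκ' K hK
    rw [← lintegral_cond_centredSquare hL]
    refine lintegral_tree_le ν hF (κ := fun z y => κ' (z - y))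
      (hκ'.comp (measurable_fst.sub measurable_snd)) (fun y => ?_) p hp
    rw [hν, lintegral_cond_centredSquare hL]
    gcongr
    refine (setLIntegral_le_lintegral _ _).trans ?_
    rw [lintegral_sub_right_eq_self]
    exact hK
  have hK₁ : ∫⁻ z, κ₁ z ≤ ENNReal.ofReal (totalConnection g) := by
    rw [totalConnection_eq, ofReal_integral_eq_lintegral_ofReal (integrable_linkProb hpos)
      (Eventually.of_forall fun z => linkProb_nonneg z)]
  have hI₁ : ∫⁻ y in centredSquare L, F₁ y ≤
      ENNReal.ofReal (4 * T ^ 2 * Real.exp (-(d * c₀))) := by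
    refine (setLIntegral_le_lintegral _ _).trans ?_
    rw [lintegral_indicator hcm, setLIntegral_const, mul_comm, ENNReal.ofReal_mul (by positivity)]
    gcongr
    rw [hcorner, volume_setOf_apply_mem (measurableSet_edgeStrip L T)
      (measurableSet_edgeStrip L T)]
    refine (mul_le_mul' (volume_edgeStrip_le L hT) (volume_edgeStrip_le L hT)).trans (le_of_eq ?_)
    rw [← ENNReal.ofReal_mul (by positivity)]
    congr 1; ring
  have hmeas : ∀ κ' : Plane → ℝ≥0∞, Measurable κ' →
      Measurable fun x : Fin (k + 1) → Plane => ∏ j : Fin k, κ' (x j.succ - x (p j)) :=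
    fun κ' hκ' => Finset.measurable_prod _ fun j _ =>
      hκ'.comp ((measurable_pi_apply _).sub (measurable_pi_apply _))
  have hΛ : 0 ≤ (d * L ^ 2) ^ (k + 1) := by positivity
  calc clusterIntegral g d L p ≤ ∫⁻ x, ENNReal.ofReal ((d * L ^ 2) ^ (k + 1)) *
        (F₁ (x 0) * ∏ j : Fin k, κ₁ (x j.succ - x (p j)) +
        F₂ (x 0) * ∏ j : Fin k, κ₂ (x j.succ - x (p j))) ∂(Measure.pi fun _ => ν) := by
        refine lintegral_mono_ae ?_
        filter_upwards [ae_forall_mem_centredSquare hL (k + 1)] with x hx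
        rw [ENNReal.ofReal_mul hΛ, mul_left_comm]
        gcongr
        exact hpoint x hx
    _ = ENNReal.ofReal ((d * L ^ 2) ^ (k + 1)) *
        (∫⁻ x, F₁ (x 0) * ∏ j : Fin k, κ₁ (x j.succ - x (p j)) ∂(Measure.pi fun _ => ν) +
        ∫⁻ x, F₂ (x 0) * ∏ j : Fin k, κ₂ (x j.succ - x (p j)) ∂(Measure.pi fun _ => ν)) := by
        have m₁ : Measurable fun x : Fin (k + 1) → Plane =>
            F₁ (x 0) * ∏ j : Fin k, κ₁ (x j.succ - x (p j)) :=
          (hF₁.comp (measurable_pi_apply 0)).mul (hmeas κ₁ hκ₁)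
        have m₂ : Measurable fun x : Fin (k + 1) → Plane =>
            F₂ (x 0) * ∏ j : Fin k, κ₂ (x j.succ - x (p j)) :=
          (hF₂.comp (measurable_pi_apply 0)).mul (hmeas κ₂ hκ₂)
        have m₁₂ : Measurable fun x : Fin (k + 1) → Plane =>
            F₁ (x 0) * ∏ j : Fin k, κ₁ (x j.succ - x (p j)) +
            F₂ (x 0) * ∏ j : Fin k, κ₂ (x j.succ - x (p j)) := m₁.add m₂
        rw [lintegral_const_mul _ m₁₂, lintegral_add_left m₁]
    _ ≤ ENNReal.ofReal ((d * L ^ 2) ^ (k + 1)) *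
        ((ENNReal.ofReal (1 / L ^ 2) * ENNReal.ofReal (4 * T ^ 2 * Real.exp (-(d * c₀)))) *
          (ENNReal.ofReal (1 / L ^ 2) * ENNReal.ofReal (totalConnection g)) ^ k +
        (ENNReal.ofReal (1 / L ^ 2) * ENNReal.ofReal J) *
          (ENNReal.ofReal (1 / L ^ 2) * ENNReal.ofReal κ) ^ k) := by
        gcongr
        · refine (htree F₁ κ₁ hF₁ hκ₁ _ hK₁).trans ?_
          gcongr
        · refine (htree F₂ κ₂ hF₂ hκ₂ _ hκ).trans ?_
          gcongr
    _ = _ := by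
        have hL2 : 0 ≤ 1 / L ^ 2 := by positivity
        have hE := (Real.exp_pos (-(d * c₀))).le
        rw [← ENNReal.ofReal_mul hL2, ← ENNReal.ofReal_mul hL2, ← ENNReal.ofReal_mul hL2,
          ← ENNReal.ofReal_mul hL2, ← ENNReal.ofReal_pow (by positivity),
          ← ENNReal.ofReal_pow (by positivity), ← ENNReal.ofReal_mul (by positivity),
          ← ENNReal.ofReal_mul (by positivity), ← ENNReal.ofReal_add (by positivity)
          (by positivity), ← ENNReal.ofReal_mul (by positivity)]
        congr 1
        -- Each of the k + 1 nodes brings the mean number d L² and the uniform density 1 / L²,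
        -- together one factor d.
        have : d * L ^ 2 * (1 / L ^ 2) = d := by field_simp
        rw [pow_succ, mul_add]
        congr 1
        · calc _ = (d * L ^ 2 * (1 / L ^ 2)) * (4 * T ^ 2 * Real.exp (-(d * c₀))) *
              ((d * L ^ 2 * (1 / L ^ 2)) * totalConnection g) ^ k := by
                rw [mul_assoc (d * L ^ 2) (1 / L ^ 2) (totalConnection g), mul_pow (d * L ^ 2)]
                ring
            _ = _ := by rw [this]
        · calc _ = (d * L ^ 2 * (1 / L ^ 2)) * J * ((d * L ^ 2 * (1 / L ^ 2)) * κ) ^ k := by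
                rw [mul_assoc (d * L ^ 2) (1 / L ^ 2) κ, mul_pow (d * L ^ 2)]
                ring
            _ = _ := by rw [this]
end

/-! ### Edge and root integrals -/

lemma integrable_exp_neg_norm : Integrable fun z : Plane => Real.exp (-‖z‖) := by
  have h := integrable_fun_norm_addHaar (volume : Measure Plane) (f := fun t : ℝ => Real.exp (-t))
  rw [h, finrank_euclideanSpace, Fintype.card_fin]
  have h2 := Real.GammaIntegral_convergent (s := 2) two_pos
  refine h2.congr_fun (fun t ht => ?_) measurableSet_Ioi
  norm_num [mul_comm]

lemma integral_exp_neg_mul_norm {s : ℝ} (hs : 0 < s) :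
    ∫ z : Plane, Real.exp (-(s * ‖z‖)) = (∫ z : Plane, Real.exp (-‖z‖)) / s ^ 2 := by
  have h := Measure.integral_comp_smul (volume : Measure Plane) (fun z => Real.exp (-‖z‖)) s
  rw [finrank_euclideanSpace, Fintype.card_fin, abs_of_pos (by positivity)] at h
  simp only [norm_smul, Real.norm_of_nonneg hs.le] at h
  rw [h, smul_eq_mul, inv_mul_eq_div]

section
variable {g : ℝ≥0 → unitInterval}

/-- Inside the unit disc the link probability is at most 1 and scaling gives s⁻²; outside, the
exponential is the constant e^(-s). With `s` proportional to the density this is O(d⁻²). -/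
lemma lintegral_linkProb_mul_exp_le (hpos : 0 < totalConnection g) {s : ℝ} (hs : 0 < s) :
    ∫⁻ z, ENNReal.ofReal (linkProb g z * Real.exp (-(s * min ‖z‖ 1))) ≤
      ENNReal.ofReal ((∫ z : Plane, Real.exp (-‖z‖)) / s ^ 2 +
        totalConnection g * Real.exp (-s)) := by
  have hI : Integrable fun z : Plane => Real.exp (-(s * ‖z‖)) := by
    have := (integrable_comp_smul_iff (volume : Measure Plane)
      (fun z => Real.exp (-‖z‖)) hs.ne').2 integrable_exp_neg_norm
    simpa only [norm_smul, Real.norm_of_nonneg hs.le] using this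
  have hI' := (integrable_linkProb hpos).mul_const (Real.exp (-s))
  have hII : Integrable fun z : Plane =>
      Real.exp (-(s * ‖z‖)) + linkProb g z * Real.exp (-s) := hI.add hI'
  rw [← integral_exp_neg_mul_norm hs, totalConnection_eq, ← integral_mul_const,
    ← integral_add hI hI', ofReal_integral_eq_lintegral_ofReal hII
    (Eventually.of_forall fun z => add_nonneg (Real.exp_pos _).le
      (mul_nonneg (linkProb_nonneg z) (Real.exp_pos _).le))]
  refine lintegral_mono fun z => ENNReal.ofReal_le_ofReal ?_
  rcases le_total ‖z‖ 1 with h | h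
  · rw [min_eq_left h]
    have h1 := mul_le_mul_of_nonneg_right (linkProb_le_one (g := g) z)
      (Real.exp_pos (-(s * ‖z‖))).le
    have h2 := mul_nonneg (linkProb_nonneg (g := g) z) (Real.exp_pos (-s)).le
    linarith
  · rw [min_eq_right h, mul_one]
    linarith [Real.exp_pos (-(s * ‖z‖))]

/-- The integral of the void probabilities over a square, split according to the distances to the
sides. -/
lemma lintegral_exp_coverage_le (hg : Antitone g) (hpos : 0 < totalConnection g) {d L w R : ℝ}
    (hd : 0 ≤ d) (hR : 0 ≤ R) (hRw : R ≤ w) (hwL : 2 * w ≤ L) :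
    ∫⁻ x in centredSquare L, ENNReal.ofReal (Real.exp (-(d * coverage g L x))) ≤
      ENNReal.ofReal (
        L ^ 2 * Real.exp (-(d * (totalConnection g - 4 * tailConnection g w))) +
        4 * w ^ 2 * Real.exp (-(d * (totalConnection g / 4 - tailConnection g w))) +
        4 * R * L * Real.exp (-(d * (totalConnection g / 2 - 2 * tailConnection g w))) +
        4 * w * L * Real.exp (-(d * (totalConnection g / 2 - 2 * tailConnection g w +
          2 * (R ^ 2 * g (2 * R).toNNReal))))) := by
  set C := totalConnection g
  set τ := tailConnection g w
  set δ : ℝ := R ^ 2 * g (2 * R).toNNReal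
  have hw0 : 0 ≤ w := hR.trans hRw
  have hL0 : 0 ≤ L := by linarith
  have hb : ∀ a b, w ≤ a → w ≤ b → C / 4 - τ ≤ boxConnection g a b := fun a b ha hb =>
    le_boxConnection hpos ha hb
  have hδ : ∀ a b, R ≤ a → R ≤ b → δ ≤ boxConnection g a b := fun a b ha hb =>
    (le_boxConnection_self hg hpos hR).trans (boxConnection_mono hpos ha hb)
  have hn : ∀ a b, 0 ≤ boxConnection g a b := fun a b => boxConnection_nonneg a b
  set I : Set ℝ := Set.Icc (-(L / 2)) (L / 2)
  have hIm : MeasurableSet I := measurableSet_Icc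
  have hIv : volume I = ENNReal.ofReal L := by rw [Real.volume_Icc]; congr 1; ring
  let P : Set ℝ → Set ℝ → Set Plane := fun S U => {x | x 0 ∈ S ∧ x 1 ∈ U}
  have hPm : ∀ {S U}, MeasurableSet S → MeasurableSet U → MeasurableSet (P S U) :=
    fun hS hU => (hS.preimage (measurable_plane_apply 0)).inter
      (hU.preimage (measurable_plane_apply 1))
  set E₁ := Real.exp (-(d * (C - 4 * τ)))
  set E₂ := Real.exp (-(d * (C / 4 - τ)))
  set E₃ := Real.exp (-(d * (C / 2 - 2 * τ)))
  set E₄ := Real.exp (-(d * (C / 2 - 2 * τ + 2 * δ)))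
  set Sw := edgeStrip L w
  set SR := edgeStrip L R
  have mw : MeasurableSet Sw := measurableSet_edgeStrip L w
  have mR : MeasurableSet SR := measurableSet_edgeStrip L R
  let ind : Set Plane → ℝ → Plane → ℝ≥0∞ := fun U E => U.indicator fun _ => ENNReal.ofReal E
  have hle : ∀ x ∈ centredSquare L, ∀ {U : Set Plane} {t : ℝ}, x ∈ U → t ≤ coverage g L x →
      ENNReal.ofReal (Real.exp (-(d * coverage g L x))) ≤ ind U (Real.exp (-(d * t))) x := by
    intro x _ U t hxU ht
    simp only [ind, Set.indicator_of_mem hxU]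
    gcongr
  -- As `2 * w ≤ L`, the farther side in each direction is at distance at least `w`. Interior points
  -- have four full boxes, corner points at least one, side points two; a side point at distance at
  -- least `R` from its side gets an extra `δ` from each of the two boxes facing that side.
  have hpoint : ∀ x ∈ centredSquare L, ENNReal.ofReal (Real.exp (-(d * coverage g L x))) ≤
      ind (P I I) E₁ x + ind (P Sw Sw) E₂ x + (ind (P SR I) E₃ x + ind (P I SR) E₃ x) +
        (ind (P Sw I) E₄ x + ind (P I Sw) E₄ x) := by
    intro x hx
    have hG := sum_boxConnection_le_coverage hpos hx
    have h0 := hx 0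
    have h1 := hx 1
    have ha0 : |x 0| ≤ L / 2 := abs_le.2 h0
    have ha1 : |x 1| ≤ L / 2 := abs_le.2 h1
    have n1 := hn (L / 2 - x 0) (L / 2 - x 1)
    have n2 := hn (L / 2 - x 0) (L / 2 + x 1)
    have n3 := hn (L / 2 + x 0) (L / 2 - x 1)
    have n4 := hn (L / 2 + x 0) (L / 2 + x 1)
    by_cases c0 : |x 0| ≤ L / 2 - w
    · have c0' := abs_le.1 c0
      by_cases c1 : |x 1| ≤ L / 2 - w
      · have c1' := abs_le.1 c1
        refine (hle x hx (U := P I I) (t := C - 4 * τ) ⟨h0, h1⟩ ?_).trans ?_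
        · linarith [hb (L / 2 - x 0) (L / 2 - x 1) (by linarith) (by linarith),
            hb (L / 2 - x 0) (L / 2 + x 1) (by linarith) (by linarith),
            hb (L / 2 + x 0) (L / 2 - x 1) (by linarith) (by linarith),
            hb (L / 2 + x 0) (L / 2 + x 1) (by linarith) (by linarith)]
        · exact le_self_add.trans (le_self_add.trans le_self_add)
      · push Not at c1
        by_cases c2 : |x 1| ≤ L / 2 - R
        · have c2' := abs_le.1 c2
          refine (hle x hx (U := P I Sw) (t := C / 2 - 2 * τ + 2 * δ)
            ⟨h0, ha1, c1.le⟩ ?_).trans (le_add_self.trans le_add_self)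
          rcases le_total 0 (x 1) with hs | hs
          · linarith [hδ (L / 2 - x 0) (L / 2 - x 1) (by linarith) (by linarith),
              hb (L / 2 - x 0) (L / 2 + x 1) (by linarith) (by linarith),
              hδ (L / 2 + x 0) (L / 2 - x 1) (by linarith) (by linarith),
              hb (L / 2 + x 0) (L / 2 + x 1) (by linarith) (by linarith)]
          · linarith [hb (L / 2 - x 0) (L / 2 - x 1) (by linarith) (by linarith),
              hδ (L / 2 - x 0) (L / 2 + x 1) (by linarith) (by linarith),
              hb (L / 2 + x 0) (L / 2 - x 1) (by linarith) (by linarith),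
              hδ (L / 2 + x 0) (L / 2 + x 1) (by linarith) (by linarith)]
        · push Not at c2
          refine (hle x hx (U := P I SR) (t := C / 2 - 2 * τ)
            ⟨h0, ha1, c2.le⟩ ?_).trans ((le_add_self.trans le_add_self).trans le_self_add)
          rcases le_total 0 (x 1) with hs | hs
          · linarith [hb (L / 2 - x 0) (L / 2 + x 1) (by linarith) (by linarith),
              hb (L / 2 + x 0) (L / 2 + x 1) (by linarith) (by linarith)]
          · linarith [hb (L / 2 - x 0) (L / 2 - x 1) (by linarith) (by linarith),
              hb (L / 2 + x 0) (L / 2 - x 1) (by linarith) (by linarith)]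
    · push Not at c0
      by_cases c1 : |x 1| ≤ L / 2 - w
      · have c1' := abs_le.1 c1
        by_cases c2 : |x 0| ≤ L / 2 - R
        · have c2' := abs_le.1 c2
          refine (hle x hx (U := P Sw I) (t := C / 2 - 2 * τ + 2 * δ)
            ⟨⟨ha0, c0.le⟩, h1⟩ ?_).trans (le_self_add.trans le_add_self)
          rcases le_total 0 (x 0) with hs | hs
          · linarith [hδ (L / 2 - x 0) (L / 2 - x 1) (by linarith) (by linarith),
              hδ (L / 2 - x 0) (L / 2 + x 1) (by linarith) (by linarith),
              hb (L / 2 + x 0) (L / 2 - x 1) (by linarith) (by linarith),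
              hb (L / 2 + x 0) (L / 2 + x 1) (by linarith) (by linarith)]
          · linarith [hb (L / 2 - x 0) (L / 2 - x 1) (by linarith) (by linarith),
              hb (L / 2 - x 0) (L / 2 + x 1) (by linarith) (by linarith),
              hδ (L / 2 + x 0) (L / 2 - x 1) (by linarith) (by linarith),
              hδ (L / 2 + x 0) (L / 2 + x 1) (by linarith) (by linarith)]
        · push Not at c2
          refine (hle x hx (U := P SR I) (t := C / 2 - 2 * τ)
            ⟨⟨ha0, c2.le⟩, h1⟩ ?_).trans ((le_self_add.trans le_add_self).trans le_self_add)
          rcases le_total 0 (x 0) with hs | hs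
          · linarith [hb (L / 2 + x 0) (L / 2 - x 1) (by linarith) (by linarith),
              hb (L / 2 + x 0) (L / 2 + x 1) (by linarith) (by linarith)]
          · linarith [hb (L / 2 - x 0) (L / 2 - x 1) (by linarith) (by linarith),
              hb (L / 2 - x 0) (L / 2 + x 1) (by linarith) (by linarith)]
      · push Not at c1
        refine (hle x hx (U := P Sw Sw) (t := C / 4 - τ) ⟨⟨ha0, c0.le⟩, ha1, c1.le⟩ ?_).trans
          ((le_add_self.trans le_self_add).trans le_self_add)
        rcases le_total 0 (x 0) with hs | hs <;> rcases le_total 0 (x 1) with hs' | hs'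
        · linarith [hb (L / 2 + x 0) (L / 2 + x 1) (by linarith) (by linarith)]
        · linarith [hb (L / 2 + x 0) (L / 2 - x 1) (by linarith) (by linarith)]
        · linarith [hb (L / 2 - x 0) (L / 2 + x 1) (by linarith) (by linarith)]
        · linarith [hb (L / 2 - x 0) (L / 2 - x 1) (by linarith) (by linarith)]
  have hind : ∀ {S U : Set ℝ} (hS : MeasurableSet S) (hU : MeasurableSet U) {a b E : ℝ}
      (ha : 0 ≤ a) (hb : 0 ≤ b) (hva : volume S ≤ ENNReal.ofReal a)
      (hvb : volume U ≤ ENNReal.ofReal b),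
      ∫⁻ x, ind (P S U) E x ≤ ENNReal.ofReal (a * b * E) := by
    intro S U hS hU a b E ha hb hva hvb
    simp only [ind]
    rw [lintegral_indicator (hPm hS hU), setLIntegral_const, mul_comm,
      ENNReal.ofReal_mul (mul_nonneg ha hb), ENNReal.ofReal_mul ha]
    gcongr
    rw [show volume (P S U) = volume S * volume U from volume_setOf_apply_mem hS hU]
    gcongr
  have hm : ∀ {S U : Set ℝ} (hS : MeasurableSet S) (hU : MeasurableSet U) (E : ℝ),
      Measurable (ind (P S U) E) := fun hS hU E => measurable_const.indicator (hPm hS hU)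
  have vw := volume_edgeStrip_le L hw0
  have vR := volume_edgeStrip_le L hR
  have h2w : 0 ≤ 2 * w := by linarith
  have h2R : 0 ≤ 2 * R := by linarith
  have e₁ := (Real.exp_pos (-(d * (C - 4 * τ)))).le
  have e₂ := (Real.exp_pos (-(d * (C / 4 - τ)))).le
  have e₃ := (Real.exp_pos (-(d * (C / 2 - 2 * τ)))).le
  have e₄ := (Real.exp_pos (-(d * (C / 2 - 2 * τ + 2 * δ)))).le
  calc _ ≤ ∫⁻ x in centredSquare L, (ind (P I I) E₁ x + ind (P Sw Sw) E₂ x +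
        (ind (P SR I) E₃ x + ind (P I SR) E₃ x) + (ind (P Sw I) E₄ x + ind (P I Sw) E₄ x)) :=
        setLIntegral_mono' (measurableSet_centredSquare L) hpoint
    _ ≤ ∫⁻ x, (ind (P I I) E₁ x + ind (P Sw Sw) E₂ x +
        (ind (P SR I) E₃ x + ind (P I SR) E₃ x) + (ind (P Sw I) E₄ x + ind (P I Sw) E₄ x)) :=
        setLIntegral_le_lintegral _ _
    _ = (∫⁻ x, ind (P I I) E₁ x) + (∫⁻ x, ind (P Sw Sw) E₂ x) +
        ((∫⁻ x, ind (P SR I) E₃ x) + ∫⁻ x, ind (P I SR) E₃ x) +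
        ((∫⁻ x, ind (P Sw I) E₄ x) + ∫⁻ x, ind (P I Sw) E₄ x) := by
        have m₄ : Measurable fun x => ind (P Sw I) E₄ x + ind (P I Sw) E₄ x :=
          (hm mw hIm E₄).add (hm hIm mw E₄)
        have m₃ : Measurable fun x => ind (P SR I) E₃ x + ind (P I SR) E₃ x :=
          (hm mR hIm E₃).add (hm hIm mR E₃)
        rw [lintegral_add_right _ m₄, lintegral_add_right _ (hm hIm mw E₄),
          lintegral_add_right _ m₃, lintegral_add_right _ (hm hIm mR E₃),
          lintegral_add_right _ (hm mw mw E₂)]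
    _ ≤ ENNReal.ofReal (L * L * E₁) + ENNReal.ofReal (2 * w * (2 * w) * E₂) +
        (ENNReal.ofReal (2 * R * L * E₃) + ENNReal.ofReal (L * (2 * R) * E₃)) +
        (ENNReal.ofReal (2 * w * L * E₄) + ENNReal.ofReal (L * (2 * w) * E₄)) := by
        gcongr
        · exact hind hIm hIm hL0 hL0 hIv.le hIv.le
        · exact hind mw mw h2w h2w vw vw
        · exact hind mR hIm h2R hL0 vR hIv.le
        · exact hind hIm mR hL0 h2R hIv.le vR
        · exact hind mw hIm h2w hL0 vw hIv.le
        · exact hind hIm mw hL0 h2w hIv.le vw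
    _ = _ := by
        rw [← ENNReal.ofReal_add (by positivity) (by positivity),
          ← ENNReal.ofReal_add (by positivity) (by positivity),
          ← ENNReal.ofReal_add (by positivity) (by positivity),
          ← ENNReal.ofReal_add (by positivity) (by positivity),
          ← ENNReal.ofReal_add (by positivity) (by positivity)]
        congr 1; ring
end

/-! ### Asymptotics in the critical regime -/

lemma tendsto_pow_mul_exp_neg_mul (n : ℕ) {b : ℝ} (hb : 0 < b) :
    Tendsto (fun t : ℝ => t ^ n * Real.exp (-(t * b))) atTop (𝓝 0) := by
  have h := (Real.tendsto_pow_mul_exp_neg_atTop_nhds_zero n).comp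
    (tendsto_id.atTop_mul_const hb)
  have h2 := h.const_mul ((b ^ n)⁻¹)
  rw [mul_zero] at h2
  refine h2.congr fun t => ?_
  simp only [Function.comp, id, mul_pow]
  field_simp

lemma mul_exp_neg_mul_le {b t : ℝ} (hb : 0 < b) : t * Real.exp (-(t * b)) ≤ 1 / b := by
  rw [Real.exp_neg, ← div_eq_mul_inv, div_le_div_iff₀ (Real.exp_pos _) hb]
  linarith [Real.add_one_le_exp (t * b)]

lemma sq_mul_exp_neg_mul_le {b t : ℝ} (hb : 0 < b) (ht : 0 ≤ t) :
    t ^ 2 * Real.exp (-(t * b)) ≤ 2 / b ^ 2 := by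
  rw [Real.exp_neg, ← div_eq_mul_inv, div_le_div_iff₀ (Real.exp_pos _) (by positivity)]
  nlinarith [Real.quadratic_le_exp_of_nonneg (mul_nonneg ht hb.le), mul_nonneg ht hb.le]

/-- The four contributions to the integral of the void probabilities, in the critical regime. -/
lemma void_bound_le {B C δ η R d L t τ : ℝ} (hB : 0 ≤ B) (hC : 0 < C)
    (hη₁ : η ≤ 2 * δ) (hη₂ : 2 * η ≤ C / 8) (hR : 0 ≤ R) (hd1 : 1 ≤ d) (hL : 0 < L)
    (hdL : d * L ^ 2 ≤ B * Real.exp (d * C)) (hdτ : d * τ ≤ t) :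
    d * (L ^ 2 * Real.exp (-(d * (C - 4 * τ))) +
      4 * Real.exp (η * d) ^ 2 * Real.exp (-(d * (C / 4 - τ))) +
      4 * R * L * Real.exp (-(d * (C / 2 - 2 * τ))) +
      4 * Real.exp (η * d) * L * Real.exp (-(d * (C / 2 - 2 * τ + 2 * δ)))) ≤
    (B * Real.exp (4 * t) + 4 * Real.exp t * (8 / C) +
      4 * (R + 1) * Real.sqrt B * Real.exp (2 * t)) * Real.sqrt d := by
  have hd0 : 0 < d := by linarith
  set w := Real.exp (η * d) with hw
  have hsd : 1 ≤ Real.sqrt d := Real.one_le_sqrt.2 hd1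
  have hsq : Real.sqrt d * Real.sqrt d = d := Real.mul_self_sqrt hd0.le
  -- The square root of `hdL`: the side strips, of length of order L and exponent dC/2, contribute
  -- of order √d, the dominant term.
  have hhalf : d * L * Real.exp (-(d * (C / 2))) ≤ Real.sqrt d * Real.sqrt B := by
    rw [← Real.sqrt_mul hd0.le]
    apply Real.le_sqrt_of_sq_le
    have he : Real.exp (-(d * (C / 2))) ^ 2 * Real.exp (d * C) = 1 := by
      rw [← Real.exp_nat_mul, ← Real.exp_add]
      convert Real.exp_zero using 2
      push_cast; ring
    calc (d * L * Real.exp (-(d * (C / 2)))) ^ 2 =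
          d * ((d * L ^ 2) * Real.exp (-(d * (C / 2))) ^ 2) := by ring
      _ ≤ d * ((B * Real.exp (d * C)) * Real.exp (-(d * (C / 2))) ^ 2) := by gcongr
      _ = d * B * (Real.exp (-(d * (C / 2))) ^ 2 * Real.exp (d * C)) := by ring
      _ = d * B := by rw [he, mul_one]
  have j1 : d * (L ^ 2 * Real.exp (-(d * (C - 4 * τ)))) ≤ B * Real.exp (4 * t) := by
    have e : Real.exp (d * C) * Real.exp (-(d * (C - 4 * τ))) = Real.exp (4 * (d * τ)) := by
      rw [← Real.exp_add]; congr 1; ring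
    calc _ = d * L ^ 2 * Real.exp (-(d * (C - 4 * τ))) := by ring
      _ ≤ B * Real.exp (d * C) * Real.exp (-(d * (C - 4 * τ))) := by gcongr
      _ = B * Real.exp (4 * (d * τ)) := by rw [mul_assoc, e]
      _ ≤ _ := by gcongr
  have j2 : d * (4 * w ^ 2 * Real.exp (-(d * (C / 4 - τ)))) ≤
      4 * Real.exp t * (8 / C) := by
    have e : w ^ 2 * Real.exp (-(d * (C / 4 - τ))) ≤
        Real.exp t * Real.exp (-(d * (C / 8))) := by
      rw [hw, ← Real.exp_nat_mul, ← Real.exp_add, ← Real.exp_add]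
      apply Real.exp_le_exp.2
      push_cast
      nlinarith [mul_le_mul_of_nonneg_left hη₂ hd0.le]
    have e2 := mul_exp_neg_mul_le (b := C / 8) (t := d) (by positivity)
    calc _ = 4 * d * (w ^ 2 * Real.exp (-(d * (C / 4 - τ)))) := by ring
      _ ≤ 4 * d * (Real.exp t * Real.exp (-(d * (C / 8)))) := by gcongr
      _ = 4 * Real.exp t * (d * Real.exp (-(d * (C / 8)))) := by ring
      _ ≤ 4 * Real.exp t * (1 / (C / 8)) := by gcongr
      _ = _ := by rw [one_div_div]
  have e3 : Real.exp (-(d * (C / 2 - 2 * τ))) ≤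
      Real.exp (-(d * (C / 2))) * Real.exp (2 * t) := by
    rw [← Real.exp_add]
    apply Real.exp_le_exp.2
    linarith
  have j3 : d * (4 * R * L * Real.exp (-(d * (C / 2 - 2 * τ)))) ≤
      4 * R * Real.sqrt B * Real.exp (2 * t) * Real.sqrt d := by
    calc _ ≤ d * (4 * R * L * (Real.exp (-(d * (C / 2))) * Real.exp (2 * t))) := by gcongr
      _ = 4 * R * Real.exp (2 * t) * (d * L * Real.exp (-(d * (C / 2)))) := by ring
      _ ≤ 4 * R * Real.exp (2 * t) * (Real.sqrt d * Real.sqrt B) := by gcongr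
      _ = _ := by ring
  have j4 : d * (4 * w * L * Real.exp (-(d * (C / 2 - 2 * τ + 2 * δ)))) ≤
      4 * Real.sqrt B * Real.exp (2 * t) * Real.sqrt d := by
    have e : w * Real.exp (-(d * (C / 2 - 2 * τ + 2 * δ))) ≤
        Real.exp (-(d * (C / 2))) * Real.exp (2 * t) := by
      rw [hw, ← Real.exp_add, ← Real.exp_add]
      apply Real.exp_le_exp.2
      nlinarith [mul_le_mul_of_nonneg_left hη₁ hd0.le]
    calc _ = 4 * d * L * (w * Real.exp (-(d * (C / 2 - 2 * τ + 2 * δ)))) := by ring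
      _ ≤ 4 * d * L * (Real.exp (-(d * (C / 2))) * Real.exp (2 * t)) := by gcongr
      _ = 4 * Real.exp (2 * t) * (d * L * Real.exp (-(d * (C / 2)))) := by ring
      _ ≤ 4 * Real.exp (2 * t) * (Real.sqrt d * Real.sqrt B) := by gcongr
      _ = _ := by ring
  have m1 : B * Real.exp (4 * t) ≤ B * Real.exp (4 * t) * Real.sqrt d :=
    le_mul_of_one_le_right (by positivity) hsd
  have m2 : 4 * Real.exp t * (8 / C) ≤ 4 * Real.exp t * (8 / C) * Real.sqrt d :=
    le_mul_of_one_le_right (by positivity) hsd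
  linarith

section
variable {g : ℝ≥0 → unitInterval}

set_option maxHeartbeats 1000000 in
/-- The first-moment integral of clusters of at least two nodes vanishes asymptotically. -/
lemma exists_clusterIntegral_le (hg : Antitone g)
    (hg_decay : (fun t : ℝ≥0 => (g t : ℝ)) =o[atTop]
      fun t : ℝ≥0 => 1 / ((t : ℝ) ^ 2 * Real.log (t : ℝ) ^ 2))
    (hpos : 0 < totalConnection g) {k : ℕ} (hk : 0 < k)
    (p : Fin k → Fin (k + 1)) (hp : ∀ j, p j ≤ j.castSucc) {B : ℝ} (hB : 0 ≤ B) :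
    ∃ (f₁ f₂ : ℝ → ℝ) (d₀ : ℝ), Tendsto f₁ atTop (𝓝 0) ∧ Tendsto f₂ atTop (𝓝 0) ∧
      ∀ d L, d₀ ≤ d → 0 < L → d * L ^ 2 ≤ B * Real.exp (d * totalConnection g) →
        clusterIntegral g d L p ≤ ENNReal.ofReal (f₁ d + f₂ (d * L ^ 2)) := by
  obtain ⟨R, hR, hγ⟩ := exists_pos_link hg hpos
  obtain ⟨c, T, hc, hT, hdisc⟩ := exists_le_discrepancy hg hg_decay hpos
  obtain ⟨ct, w₀, hct, hw₀, htail⟩ := exists_tailConnection_le hg_decay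
  set C := totalConnection g
  set γ : ℝ := (g (2 * R).toNNReal : ℝ) with hγdef
  set δ : ℝ := R ^ 2 * γ with hδdef
  have hδ : 0 < δ := by positivity
  have hk' : (0 : ℝ) < k := by exact_mod_cast hk
  -- the exponential rate of the width of the boundary strips
  obtain ⟨η, hη, hη₁, hη₂, hη₃⟩ : ∃ η : ℝ, 0 < η ∧ η ≤ 2 * δ ∧ 2 * η ≤ C / 8 ∧
      2 * η * (k + 1) ≤ δ / 2 := by
    -- The three constraints make e^(ηd) harmless, respectively, in the side strips (against the
    -- gain 2δ), in the corners (against C/4), and to the power 2(k + 1) in squares of side below 2w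
    -- (against δ).
    refine ⟨min (min (2 * δ) (C / 16)) (δ / (4 * (k + 1))), by positivity, ?_, ?_, ?_⟩
    · exact (min_le_left _ _).trans (min_le_left _ _)
    · have := (min_le_left (min (2 * δ) (C / 16)) (δ / (4 * (k + 1)))).trans (min_le_right _ _)
      linarith
    · have h := min_le_right (min (2 * δ) (C / 16)) (δ / (4 * (k + 1)))
      rw [le_div_iff₀ (by positivity)] at h
      linarith
  set c' := c / (4 * k) with hc'def
  have hc' : 0 < c' := by positivity
  set N := ∫ z : Plane, Real.exp (-‖z‖)
  have hN : 0 ≤ N := integral_nonneg fun z => (Real.exp_pos _).le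
  set t := ct / η with htdef
  set A := B * Real.exp (4 * t) + 4 * Real.exp t * (8 / C) +
    4 * (R + 1) * Real.sqrt B * Real.exp (2 * t) with hA
  set D := N / c' ^ 2 + C * (2 / c' ^ 2) with hD
  have hA0 : 0 ≤ A := by positivity
  have hD0 : 0 ≤ D := by positivity
  -- The summands of the first function come from squares with R ≤ L < 2w, from roots near a corner,
  -- and from the main term; the second function covers L < R. The threshold ensures d ≥ 1, d ≥ D, w
  -- ≥ w₀ and w ≥ max R T.
  refine ⟨fun d => 4 ^ (k + 1) * (d ^ (k + 1) * Real.exp (-(d * (δ / 2)))) +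
    4 * T ^ 2 * C ^ k * (d ^ (k + 1) * Real.exp (-(d * δ))) + A * D * (Real.sqrt d)⁻¹,
    fun r => r ^ (k + 1) * Real.exp (-(r * γ)),
    max (max 1 D) (max (Real.log w₀ / η) (max (Real.log (max R T) / η) 0)), ?_,
    tendsto_pow_mul_exp_neg_mul _ hγ, ?_⟩
  · have h1 := (tendsto_pow_mul_exp_neg_mul (k + 1) (half_pos hδ)).const_mul (4 ^ (k + 1))
    have h2 := (tendsto_pow_mul_exp_neg_mul (k + 1) hδ).const_mul (4 * T ^ 2 * C ^ k)
    have h3 := (tendsto_inv_atTop_zero.comp Real.tendsto_sqrt_atTop).const_mul (A * D)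
    simpa using (h1.add h2).add h3
  intro d L hd hL hdL
  have hd1 : 1 ≤ d := ((le_max_left _ _).trans (le_max_left _ _)).trans hd
  have hdD : D ≤ d := ((le_max_right _ _).trans (le_max_left _ _)).trans hd
  have hd0 : 0 < d := by linarith
  set w := Real.exp (η * d) with hw
  have hww : w₀ ≤ w := by
    have h := ((le_max_left _ _).trans (le_max_right _ _)).trans hd
    rw [div_le_iff₀ hη] at h
    rw [hw, ← Real.log_le_iff_le_exp (by linarith)]
    linarith
  have hRTw : max R T ≤ w := by
    have h := ((le_max_left _ _).trans ((le_max_right _ _).trans (le_max_right _ _))).trans hd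
    rw [div_le_iff₀ hη] at h
    rw [hw, ← Real.log_le_iff_le_exp (lt_max_of_lt_left hR)]
    linarith
  have hRw : R ≤ w := (le_max_left _ _).trans hRTw
  have hTw : T ≤ w := (le_max_right _ _).trans hRTw
  have hw0 : 0 < w := Real.exp_pos _
  have hr0 : 0 ≤ d * L ^ 2 := by positivity
  have n1 : 0 ≤ (4 : ℝ) ^ (k + 1) * (d ^ (k + 1) * Real.exp (-(d * (δ / 2)))) := by positivity
  have n2 : 0 ≤ 4 * T ^ 2 * C ^ k * (d ^ (k + 1) * Real.exp (-(d * δ))) := by positivity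
  have n3 : 0 ≤ A * D * (Real.sqrt d)⁻¹ := by positivity
  have n4 : 0 ≤ (d * L ^ 2) ^ (k + 1) * Real.exp (-(d * L ^ 2 * γ)) := by positivity
  by_cases hLw : L < 2 * w
  · by_cases hLR : L < R
    · refine (clusterIntegral_le_of_coverage hg hpos hd0.le hL (c := L ^ 2 * γ) (fun x hx =>
        sq_mul_le_coverage hg hpos hL.le hLR.le le_rfl hx) p).trans
        (ENNReal.ofReal_le_ofReal ?_)
      rw [← mul_assoc d]
      linarith
    · push Not at hLR
      refine (clusterIntegral_le_of_coverage hg hpos hd0.le hL (c := δ) (fun x hx =>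
        sq_mul_le_coverage hg hpos hR.le le_rfl hLR hx) p).trans (ENNReal.ofReal_le_ofReal ?_)
      have hL2 : L ^ 2 ≤ 4 * Real.exp (2 * η * d) := by
        have : Real.exp (2 * η * d) = w ^ 2 := by
          rw [hw, ← Real.exp_nat_mul]
          congr 1; push_cast; ring
        rw [this]
        nlinarith
      have h1 : (d * L ^ 2) ^ (k + 1) * Real.exp (-(d * δ)) ≤
          4 ^ (k + 1) * (d ^ (k + 1) * Real.exp (-(d * (δ / 2)))) := by
        calc _ ≤ (d * (4 * Real.exp (2 * η * d))) ^ (k + 1) * Real.exp (-(d * δ)) := by gcongr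
          _ = 4 ^ (k + 1) * (d ^ (k + 1) *
              (Real.exp (2 * η * d) ^ (k + 1) * Real.exp (-(d * δ)))) := by ring
          _ ≤ 4 ^ (k + 1) * (d ^ (k + 1) * Real.exp (-(d * (δ / 2)))) := by
              gcongr
              rw [← Real.exp_nat_mul, ← Real.exp_add]
              apply Real.exp_le_exp.2
              push_cast
              nlinarith [mul_le_mul_of_nonneg_left hη₃ hd0.le]
      linarith
  · push Not at hLw
    have hRL : R ≤ L := by linarith
    have hTL : T ≤ L := by linarith
    have hlog : Real.log w = η * d := Real.log_exp _
    -- Since log w = ηd, the tail bound cancels the factor `d`: replacing the full connection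
    -- integral by its part within radius `w` changes exponents by a bounded amount.
    have hdτ : d * tailConnection g w ≤ t := by
      have h := htail w hww
      rw [hlog] at h
      calc d * tailConnection g w ≤ d * (ct / (η * d)) := by gcongr
        _ = t := by rw [htdef]; field_simp
    set τ := tailConnection g w
    have hJ := lintegral_exp_coverage_le hg hpos (d := d) hd0.le hR.le hRw hLw
    have hκ := lintegral_linkProb_mul_exp_le hpos (s := d * c') (by positivity)
    refine (clusterIntegral_le_of_discrepancy hg hpos hd0.le hL hc.le hT.le (hdisc L hTL)
      (c₀ := δ) (fun x hx => sq_mul_le_coverage hg hpos hR.le le_rfl hRL hx) hk p hp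
      (by positivity) (by positivity) hJ hκ).trans (ENNReal.ofReal_le_ofReal ?_)
    have hcorner : d * (4 * T ^ 2 * Real.exp (-(d * δ))) * (d * C) ^ k =
        4 * T ^ 2 * C ^ k * (d ^ (k + 1) * Real.exp (-(d * δ))) := by ring
    have hκd : d * (N / (d * c') ^ 2 + C * Real.exp (-(d * c'))) ≤ D / d := by
      rw [le_div_iff₀ hd0, hD]
      calc _ = N / c' ^ 2 + C * (d ^ 2 * Real.exp (-(d * c'))) := by field_simp
        _ ≤ N / c' ^ 2 + C * (2 / c' ^ 2) := by
            gcongr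
            exact sq_mul_exp_neg_mul_le hc' hd0.le
    have hsq : Real.sqrt d * Real.sqrt d = d := Real.mul_self_sqrt hd0.le
    have hJd := void_bound_le hB hpos hη₁ hη₂ hR.le hd1 hL hdL hdτ
    have hmain : d * (L ^ 2 * Real.exp (-(d * (C - 4 * τ))) +
        4 * w ^ 2 * Real.exp (-(d * (C / 4 - τ))) +
        4 * R * L * Real.exp (-(d * (C / 2 - 2 * τ))) +
        4 * w * L * Real.exp (-(d * (C / 2 - 2 * τ + 2 * (R ^ 2 * γ))))) *
        (d * (N / (d * c') ^ 2 + C * Real.exp (-(d * c')))) ^ k ≤ A * D * (Real.sqrt d)⁻¹ := by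
      have hDd : D / d ≤ 1 := (div_le_one hd0).2 hdD
      -- One edge factor D / d already beats √d; the others are at most 1 because `D ≤ d`.
      calc _ ≤ A * Real.sqrt d * (D / d) ^ k := by gcongr
        _ ≤ A * Real.sqrt d * (D / d) := by
            gcongr
            exact pow_le_of_le_one (by positivity) hDd hk.ne'
        _ = A * D * (Real.sqrt d)⁻¹ := by
            have : Real.sqrt d ≠ 0 := by positivity
            nth_rewrite 2 [← hsq]
            field_simp
    rw [hcorner]
    linarith
end

/-! ### Specialization to the critical scaling and conclusion -/

section
variable {g : ℝ≥0 → unitInterval}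

lemma nodeDensity_mul_sq (hpos : 0 < totalConnection g) {b ρ : ℝ} (hρ : 0 < ρ)
    (hb : 0 < Real.log ρ + b) :
    0 < 1 / criticalRange g b ρ ∧
      nodeDensity g b ρ * (1 / criticalRange g b ρ) ^ 2 = ρ := by
  have hq : 0 < (Real.log ρ + b) / (totalConnection g * ρ) := by positivity
  refine ⟨one_div_pos.2 (Real.sqrt_pos.2 hq), ?_⟩
  rw [criticalRange, nodeDensity, div_pow, Real.sq_sqrt hq.le]
  field_simp

lemma exp_nodeDensity_mul (hpos : 0 < totalConnection g) {b ρ : ℝ} (hρ : 0 < ρ) :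
    Real.exp (nodeDensity g b ρ * totalConnection g) = ρ * Real.exp b := by
  rw [nodeDensity, div_mul_cancel₀ _ hpos.ne', Real.exp_add, Real.exp_log hρ]

/-- Only an eventual lower bound on b is needed, which covers both the constant and the divergent
case. The density tends to infinity and the mean number of nodes is ρ, so both error functions of
`exists_clusterIntegral_le` vanish. -/
lemma tendsto_finiteNetworkLaw_exists_component (hg_anti : Antitone g)
    (hg_decay : (fun t : ℝ≥0 => (g t : ℝ)) =o[atTop]
      fun t : ℝ≥0 => 1 / ((t : ℝ) ^ 2 * Real.log (t : ℝ) ^ 2))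
    (hg_pos : 0 < totalConnection g) {b : ℝ → ℝ} {b₀ : ℝ} (hb : ∀ᶠ ρ in atTop, b₀ ≤ b ρ)
    (M : ℕ) :
    Tendsto (fun ρ : ℝ => finiteNetworkLaw g (b ρ) ρ
        {ω | ∃ c : (connectionGraph g ω).ConnectedComponent,
          1 < c.supp.ncard ∧ c.supp.ncard ≤ M}) atTop (𝓝 0) := by
  have hlarge : ∀ᶠ ρ : ℝ in atTop, 0 < Real.log ρ + b₀ := by
    have h := tendsto_atTop_add_const_right atTop b₀ Real.tendsto_log_atTop
    exact h.eventually_gt_atTop 0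
  have hdens : Tendsto (fun ρ => nodeDensity g (b ρ) ρ) atTop atTop := by
    have h := (tendsto_atTop_add_const_right atTop b₀ Real.tendsto_log_atTop).atTop_div_const
      hg_pos
    refine tendsto_atTop_mono' atTop ?_ h
    filter_upwards [hb] with ρ hρ
    unfold nodeDensity
    gcongr
  have hterm : ∀ k ∈ Finset.Ico 1 M,
      ∀ p : {p : Fin k → Fin (k + 1) // ∀ j, p j ≤ j.castSucc},
      Tendsto (fun ρ : ℝ => clusterIntegral g (nodeDensity g (b ρ) ρ)
        (1 / criticalRange g (b ρ) ρ) p.1) atTop (𝓝 0) := by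
    intro k hk p
    obtain ⟨f₁, f₂, d₀, hf₁, hf₂, hf⟩ := exists_clusterIntegral_le hg_anti hg_decay hg_pos
      (Finset.mem_Ico.1 hk).1 p.1 p.2 (Real.exp_pos (-b₀)).le
    have hlim : Tendsto (fun ρ : ℝ => ENNReal.ofReal (f₁ (nodeDensity g (b ρ) ρ) + f₂ ρ))
        atTop (𝓝 0) := by
      have := ENNReal.tendsto_ofReal ((hf₁.comp hdens).add hf₂)
      simpa using this
    refine tendsto_of_tendsto_of_tendsto_of_le_of_le' tendsto_const_nhds hlim
      (Eventually.of_forall fun _ => bot_le) ?_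
    filter_upwards [hb, hlarge, eventually_gt_atTop 0, hdens.eventually_ge_atTop d₀]
      with ρ hbρ hlρ hρ hd
    obtain ⟨hL, hLρ⟩ := nodeDensity_mul_sq hg_pos (b := b ρ) hρ (by linarith)
    have h := hf (nodeDensity g (b ρ) ρ) (1 / criticalRange g (b ρ) ρ) hd hL
      (by
        -- Here d L² = ρ and e^(dC) = ρ e^b, so `B = exp (-b₀)` works as soon as b ≥ b₀.
        rw [hLρ, exp_nodeDensity_mul hg_pos hρ, mul_left_comm, ← Real.exp_add]
        exact le_mul_of_one_le_right hρ.le (Real.one_le_exp (by linarith)))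
    rwa [hLρ] at h
  have hsum : Tendsto (fun ρ : ℝ => ∑ k ∈ Finset.Ico 1 M,
      ∑ p : {p : Fin k → Fin (k + 1) // ∀ j, p j ≤ j.castSucc},
      clusterIntegral g (nodeDensity g (b ρ) ρ) (1 / criticalRange g (b ρ) ρ) p.1)
      atTop (𝓝 0) := by
    have := tendsto_finsetSum (Finset.Ico 1 M) fun k hk =>
      tendsto_finsetSum Finset.univ fun p _ => hterm k hk p
    simpa using this
  refine tendsto_of_tendsto_of_tendsto_of_le_of_le' tendsto_const_nhds hsum
    (Eventually.of_forall fun _ => bot_le) ?_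
  filter_upwards [hb, hlarge, eventually_gt_atTop 0, hdens.eventually_ge_atTop 0]
    with ρ hbρ hlρ hρ hd
  obtain ⟨hL, -⟩ := nodeDensity_mul_sq hg_pos (b := b ρ) hρ (by linarith)
  have h := networkLaw_exists_component_le_sum hg_anti (nodeDensity g (b ρ) ρ).toNNReal hL M
  rwa [Real.coe_toNNReal _ hd] at h

end

theorem theorem4 (g : ℝ≥0 → unitInterval)
    (hg_anti : Antitone g)
    (hg_decay : (fun t : ℝ≥0 => (g t : ℝ)) =o[atTop]
      fun t : ℝ≥0 => 1 / ((t : ℝ) ^ 2 * Real.log (t : ℝ) ^ 2))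
    (hg_pos : 0 < totalConnection g)
    (b : ℝ → ℝ)
    (hb : (∃ b₀ : ℝ, ∀ ρ, b ρ = b₀) ∨ Tendsto b atTop atTop)
    (M : ℕ) :
    Tendsto
      (fun ρ : ℝ => finiteNetworkLaw g (b ρ) ρ
        {ω | ∀ c : (connectionGraph g ω).ConnectedComponent,
          ¬ (1 < c.supp.ncard ∧ c.supp.ncard ≤ M)})
      atTop (𝓝 1) := by
  obtain ⟨b₀, hb₀⟩ : ∃ b₀, ∀ᶠ ρ in atTop, b₀ ≤ b ρ := by
    rcases hb with ⟨b₀, h⟩ | h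
    · exact ⟨b₀, Eventually.of_forall fun ρ => (h ρ).ge⟩
    · exact ⟨0, h.eventually_ge_atTop 0⟩
  have hbad := tendsto_finiteNetworkLaw_exists_component hg_anti hg_decay hg_pos hb₀ M
  have hlow := ENNReal.Tendsto.sub (tendsto_const_nhds (x := (1 : ℝ≥0∞))) hbad
    (Or.inl ENNReal.one_ne_top)
  rw [tsub_zero] at hlow
  have hlarge : ∀ᶠ ρ : ℝ in atTop, 0 < Real.log ρ + b₀ :=
    (tendsto_atTop_add_const_right atTop b₀ Real.tendsto_log_atTop).eventually_gt_atTop 0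
  have huniv : ∀ᶠ ρ : ℝ in atTop, finiteNetworkLaw g (b ρ) ρ Set.univ = 1 := by
    filter_upwards [hb₀, hlarge, eventually_gt_atTop 0] with ρ hbρ hlρ hρ
    obtain ⟨hL, -⟩ := nodeDensity_mul_sq hg_pos (b := b ρ) hρ (by linarith)
    refine networkLaw_univ _ ?_ (volume_centredSquare_ne_top _)
    rw [volume_centredSquare hL.le]
    exact (ENNReal.ofReal_pos.2 (by positivity)).ne'
  refine tendsto_of_tendsto_of_tendsto_of_le_of_le' hlow tendsto_const_nhds ?_ ?_
  · filter_upwards [huniv] with ρ hρ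
    -- Subadditivity gives 1 ≤ P(good) + P(bad) without measurability of either event.
    rw [tsub_le_iff_right, ← hρ]
    refine (measure_mono fun ω _ => ?_).trans (measure_union_le _ _)
    by_cases h : ∃ c : (connectionGraph g ω).ConnectedComponent,
        1 < c.supp.ncard ∧ c.supp.ncard ≤ M
    · exact Or.inr h
    · exact Or.inl (not_exists.1 h)
  · filter_upwards [huniv] with ρ hρ
    rw [← hρ]
    exact measure_mono (Set.subset_univ _)
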